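/- **Conventions.** An *$\infty$-cosmos* $\mathcal K$ is a simplicially enriched category whose mapping simplicial sets $\mathrm{Fun}(A,B)$ are quasi-categories, together with a subcategory of *isofibrations*, such that: (a) $\mathcal K$ has, as simplicially enriched limits, a terminal object $1$, cotensors $A^U$ of objects by simplicial sets, and pullbacks of isofibrations along arbitrary morphisms; (b) the isofibrations contain the isomorphisms and all morphisms $A\to 1$, are stable under pullback, for every isofibration $p\colon E\to B$ and every monomorphism $U\hookrightarrow V$ of simplicial sets the morphism $E^V\to E^U\times_{B^U}B^V$ is an isofibration, and $\mathrm{Fun}(X,p)$ is an isofibration of quasi-categories for all $X$; (c) every object has the left lifting property against the isofibrations that are equivalences. Here a morphism (*functor*) $f\colon A\to B$ of $\mathcal K$ is an *equivalence* if $\mathrm{Fun}(X,f)$ is an equivalence of quasi-categories for all $X\in\mathcal K$. The *homotopy 2-category* $\mathcal K_2$ has the objects and morphisms of $\mathcal K$, and its hom-categories $\hom(A,B)=h\,\mathrm{Fun}(A,B)$ are the homotopy categories of the mapping quasi-categories. Write $A\simeq B$ if there are $f\colon A\to B$, $g\colon B\to A$ and invertible 2-cells $\mathrm{id}_A\cong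 gf$, $fg\cong\mathrm{id}_B$ in $\mathcal K_2$; such an $f$ is an *equivalence in $\mathcal K_2$*. An object $E$ is *groupoidal* if every 2-cell of $\mathcal K_2$ with codomain $E$ is invertible. For $C\xrightarrow{g}A\xleftarrow{f}B$, the *comma $\infty$-category* $f\downarrow g\to C\times B$ is the pullback of $(p_1,p_0)\colon A^{\Delta^1}\to A\times A$ along $g\times f\colon C\times B\to A\times A$, where $p_1,p_0$ are the codomain and domain projections. Objects $E$ and $E'$ over $C\times B$ are *equivalent over $C\times B$* if there is an equivalence $E\to E'$ commuting with the morphisms to $C\times B$. A *functor of $\infty$-cosmoi* is a simplicial functor preserving isofibrations and the limits in (a); it induces a 2-functor $F_2\colon\mathcal K_2\to\mathcal L_2$. It is a *weak equivalence* if for each $X\in\mathcal L$ there is $A\in\mathcal K$ with $FA\simeq X$, and each map $\mathrm{Fun}(A,B)\to\mathrm{Fun}(FA,FB)$ is an equivalence of quasi-categories. **Proposition.** Let $F\colon\mathcal K\to\mathcal L$ be a weak equivalence of $\infty$-cosmoi. Then: 1. $F_2$ is a biequivalence: it is surjective on objects up to equivalence, and $\hom(A,B)\to\hom(FA,FB)$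 is an equivalence of categories for all $A,B\in\mathcal K$. 2. For all $A,B\in\mathcal K$, the functor $\hom(A,B)\to\hom(FA,FB)$ induces a bijection on isomorphism classes of objects. 3. $A\in\mathcal K$ is groupoidal if and only if $FA\in\mathcal L$ is groupoidal. 4. For $A,B\in\mathcal K$: $A\simeq B$ if and only if $FA\simeq FB$. 5. A functor $f\colon A\to B$ in $\mathcal K$ is an equivalence if and only if $Ff$ is an equivalence, and $f$ is an equivalence in $\mathcal K_2$ if and only if $Ff$ is an equivalence in $\mathcal L_2$. 6. For $C\xrightarrow{g}A\xleftarrow{f}B$ in $\mathcal K$ there is an isomorphism $Ff\downarrow Fg\cong F(f\downarrow g)$ over $FC\times FB$, and for every isofibration $E\to C\times B$ in $\mathcal K$: $E\simeq f\downarrow g$ over $C\times B$ if and only if $FE\simeq Ff\downarrow Fg$ over $FC\times FB$. -/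

import Mathlib

open CategoryTheory MonoidalCategory CartesianMonoidalCategory Simplicial

universe v u u₁ u₂

noncomputable section

namespace InfCosmos

/-! ### Quasi-categories: equivalences and isofibrations

`SSet.coherentIso` is the interval `𝕀`: the nerve of the free category containing an isomorphism,
with vertices `x₀` and `x₁`. -/

/-- A map `f : S ⟶ T` of simplicial sets (in practice, of quasi-categories) is an equivalence if
there are a map `g : T ⟶ S` and maps `S ⟶ S^𝕀` and `T ⟶ T^𝕀` (here in transposed form) that
restrict along the vertices of `𝕀` to `id`, `gf` and to `fg`, `id` respectively. -/
def IsQCatEquivalence {S T : SSet.{v}} (f : S ⟶ T) : Prop :=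
  ∃ (g : T ⟶ S) (h : S ⊗ SSet.coherentIso.{v} ⟶ S) (k : T ⊗ SSet.coherentIso.{v} ⟶ T),
    lift (𝟙 S) (SSet.const SSet.coherentIso.x₀) ≫ h = 𝟙 S ∧
    lift (𝟙 S) (SSet.const SSet.coherentIso.x₁) ≫ h = f ≫ g ∧
    lift (𝟙 T) (SSet.const SSet.coherentIso.x₀) ≫ k = g ≫ f ∧
    lift (𝟙 T) (SSet.const SSet.coherentIso.x₁) ≫ k = 𝟙 T

/-- An isofibration of quasi-categories: a map with the right lifting property against the inner
horn inclusions and against the two endpoint inclusions `Δ[0] ⟶ 𝕀`. -/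
structure IsQCatIsofibration {S T : SSet.{v}} (p : S ⟶ T) : Prop where
  inner : SSet.innerFibrations p
  lift_x₀ : HasLiftingProperty
    (SSet.yonedaEquiv.symm SSet.coherentIso.x₀ : Δ[0] ⟶ SSet.coherentIso.{v}) p
  lift_x₁ : HasLiftingProperty
    (SSet.yonedaEquiv.symm SSet.coherentIso.x₁ : Δ[0] ⟶ SSet.coherentIso.{v}) p

/-! ### Simplicially enriched limits

In a simplicial category `K`, `A ⟶[SSet] B` is the mapping simplicial set `Fun(A, B)`, the
morphisms `A ⟶ B` correspond to its vertices, `eHomWhiskerLeft SSet X f` is `Fun(X, f)` and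
`eHomWhiskerRight SSet h B` is `Fun(h, B)`. -/

section Limits

variable {K : Type u} [Category.{v} K] [SimplicialCategory K]

/-- `T` is a simplicially enriched terminal object: every `Fun(X, T)` is a point. -/
def IsSimplicialTerminal (T : K) : Prop :=
  ∀ X : K, Nonempty (Limits.IsTerminal (X ⟶[SSet.{v}] T))

/-- The span `C ← P → B` is a simplicially enriched product of `C` and `B`. -/
def IsSimplicialProduct {P C B : K} (π₁ : P ⟶ C) (π₀ : P ⟶ B) : Prop :=
  ∀ X : K, Nonempty (Limits.IsLimit (Limits.BinaryFan.mk
    (eHomWhiskerLeft SSet.{v} X π₁) (eHomWhiskerLeft SSet.{v} X π₀)))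

/-- The square with `fst ≫ f = snd ≫ g` is a simplicially enriched pullback. -/
def IsSimplicialPullback {P A B C : K} (fst : P ⟶ A) (snd : P ⟶ B) (f : A ⟶ C) (g : B ⟶ C) :
    Prop :=
  ∀ X : K, IsPullback (eHomWhiskerLeft SSet.{v} X fst) (eHomWhiskerLeft SSet.{v} X snd)
    (eHomWhiskerLeft SSet.{v} X f) (eHomWhiskerLeft SSet.{v} X g)

/-- The canonical map `Fun(X, P) ⟶ Fun(X, A)^U` determined by `η : U ⟶ Fun(P, A)`. -/
def cotensorComparison {A P : K} {U : SSet.{v}} (η : U ⟶ (P ⟶[SSet.{v}] A)) (X : K) :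
    (X ⟶[SSet.{v}] P) ⟶ (ihom U).obj (X ⟶[SSet.{v}] A) :=
  MonoidalClosed.curry
    ((η ▷ (X ⟶[SSet.{v}] P)) ≫ lift (snd _ _) (fst _ _) ≫ eComp SSet.{v} X P A)

/-- `P`, with `η : U ⟶ Fun(P, A)`, is a simplicial cotensor `A^U`. -/
def IsCotensor {A P : K} {U : SSet.{v}} (η : U ⟶ (P ⟶[SSet.{v}] A)) : Prop :=
  ∀ X : K, IsIso (cotensorComparison η X)

/-- For cotensors `P = A^V` and `Q = B^U`, a map `i : U ⟶ V` of simplicial sets and a morphism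
`f : A ⟶ B`, this says that `h : P ⟶ Q` is the induced morphism `f^i : A^V ⟶ B^U`. -/
def IsCotensorMap {A B P Q : K} {U V : SSet.{v}} (i : U ⟶ V) (f : A ⟶ B)
    (ηP : V ⟶ (P ⟶[SSet.{v}] A)) (ηQ : U ⟶ (Q ⟶[SSet.{v}] B)) (h : P ⟶ Q) : Prop :=
  i ≫ ηP ≫ eHomWhiskerLeft SSet.{v} P f = ηQ ≫ eHomWhiskerRight SSet.{v} h B

/-- A morphism `f : A ⟶ B` is an equivalence if `Fun(X, f)` is an equivalence of quasi-categories
for every object `X`. -/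
def IsEquivalence {A B : K} (f : A ⟶ B) : Prop :=
  ∀ X : K, IsQCatEquivalence (eHomWhiskerLeft SSet.{v} X f)

end Limits

/-! ### ∞-cosmoi -/

/-- An ∞-cosmos. -/
class InfinityCosmos (K : Type u) [Category.{v} K] [SimplicialCategory K] where
  /-- The class of isofibrations. -/
  isofib : MorphismProperty K
  quasicategory_hom : ∀ A B : K, SSet.Quasicategory (A ⟶[SSet.{v}] B)
  -- The isofibrations form a subcategory, which contains the isomorphisms.
  isofib_comp : ∀ {A B C : K} (f : A ⟶ B) (g : B ⟶ C), isofib f → isofib g → isofib (f ≫ g)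
  isofib_of_isIso : ∀ {A B : K} (f : A ⟶ B), IsIso f → isofib f
  -- Completeness.
  exists_terminal : ∃ T : K, IsSimplicialTerminal T
  exists_cotensor : ∀ (A : K) (U : SSet.{v}), ∃ (P : K) (η : U ⟶ (P ⟶[SSet.{v}] A)), IsCotensor η
  exists_pullback : ∀ {E A B : K} (p : E ⟶ B) (f : A ⟶ B), isofib p →
    ∃ (P : K) (fst : P ⟶ E) (snd : P ⟶ A), IsSimplicialPullback fst snd p f
  -- Isofibrations.
  isofib_to_terminal : ∀ {A T : K} (f : A ⟶ T), IsSimplicialTerminal T → isofib f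
  isofib_pullback : ∀ {P E A B : K} (fst : P ⟶ E) (snd : P ⟶ A) (p : E ⟶ B) (f : A ⟶ B),
    IsSimplicialPullback fst snd p f → isofib p → isofib snd
  /-- The Leibniz cotensor `E^V ⟶ E^U ×_{B^U} B^V` of a monomorphism `i : U ⟶ V` and an
  isofibration `p : E ⟶ B` is an isofibration. -/
  isofib_leibniz : ∀ {E B : K} (p : E ⟶ B) {U V : SSet.{v}} (i : U ⟶ V), isofib p → Mono i →
    ∀ {EV EU BV BU : K} (ηEV : V ⟶ (EV ⟶[SSet.{v}] E)) (ηEU : U ⟶ (EU ⟶[SSet.{v}] E))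
      (ηBV : V ⟶ (BV ⟶[SSet.{v}] B)) (ηBU : U ⟶ (BU ⟶[SSet.{v}] B)),
      IsCotensor ηEV → IsCotensor ηEU → IsCotensor ηBV → IsCotensor ηBU →
    ∀ (pU : EU ⟶ BU) (Bi : BV ⟶ BU),
      IsCotensorMap (𝟙 U) p ηEU ηBU pU → IsCotensorMap i (𝟙 B) ηBV ηBU Bi →
    ∀ {Q : K} (fst : Q ⟶ EU) (snd : Q ⟶ BV), IsSimplicialPullback fst snd pU Bi →
    ∀ l : EV ⟶ Q, IsCotensorMap i (𝟙 E) ηEV ηEU (l ≫ fst) →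
      IsCotensorMap (𝟙 V) p ηEV ηBV (l ≫ snd) → isofib l
  isofib_hom : ∀ (X : K) {E B : K} (p : E ⟶ B), isofib p →
    IsQCatIsofibration (eHomWhiskerLeft SSet.{v} X p)
  /-- Cofibrancy: every object lifts against the trivial fibrations. -/
  cofibrant : ∀ {A E B : K} (p : E ⟶ B) (b : A ⟶ B), isofib p → IsEquivalence p →
    ∃ e : A ⟶ E, e ≫ p = b


/-! ### The homotopy 2-category -/

/-- Applying the homotopy category functor to the mapping simplicial sets of `K`. -/
instance homotopyEnrichment (K : Type u) [Category.{v} K] [SimplicialCategory K] :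
    EnrichedOrdinaryCategory Cat.{v, v} (TransportEnrichment SSet.hoFunctor.{v} K) :=
  TransportEnrichment.enrichedOrdinaryCategory K SSet.hoFunctor.{v}
    (fun X => (SSet.hoFunctor.unitHomEquiv X).trans (Functor.equivCatHom _ _))
    (fun X x => congrArg Functor.toCatHom (SSet.hoFunctor.unitHomEquiv_eq X x))

/-- The homotopy 2-category of `K`, a strict bicategory: its objects and 1-cells are those of `K`,
and its 2-cells are the morphisms of the homotopy categories of the mapping simplicial sets. -/
abbrev HomotopyTwoCategory (K : Type u) [Category.{v} K] [SimplicialCategory K] : Type u :=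
  CatEnrichedOrdinary (TransportEnrichment SSet.hoFunctor.{v} K)

section TwoCategories

open Bicategory

variable {𝓑 : Type u₁} [Bicategory.{v, v} 𝓑] {𝓒 : Type u₂} [Bicategory.{v, v} 𝓒]

/-- A 1-cell of a 2-category is an equivalence if it has an inverse up to invertible 2-cells. -/
def IsEquivalence₂ {A B : 𝓑} (f : A ⟶ B) : Prop :=
  ∃ g : B ⟶ A, Nonempty (𝟙 A ≅ f ≫ g) ∧ Nonempty (g ≫ f ≅ 𝟙 B)

/-- `A ≃ B`: there is an equivalence between the objects `A` and `B`. -/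
def AreEquivalent (A B : 𝓑) : Prop :=
  ∃ f : A ⟶ B, IsEquivalence₂ f

/-- An object is groupoidal if every 2-cell with codomain that object is invertible. -/
def IsGroupoidal (E : 𝓑) : Prop :=
  ∀ (X : 𝓑) (f g : X ⟶ E) (α : f ⟶ g), IsIso α

/-- A 2-functor is a biequivalence if it is surjective on objects up to equivalence and a local
equivalence of categories. -/
def IsBiequivalence (G : StrictPseudofunctor 𝓑 𝓒) : Prop :=
  (∀ Y : 𝓒, ∃ X : 𝓑, AreEquivalent (G.obj X) Y) ∧
    ∀ A B : 𝓑, (G.mapFunctor A B).IsEquivalence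

end TwoCategories

/-! ### The 2-functor induced by a simplicial functor -/

section TwoFunctor

variable {K : Type u₁} [Category.{v} K] [SimplicialCategory K]
  {L : Type u₂} [Category.{v} L] [SimplicialCategory L]

/-- The action of a simplicial functor on the morphisms of the underlying categories. -/
def onHom (F : EnrichedFunctor SSet.{v} K L) {A B : K} (f : A ⟶ B) : F.obj A ⟶ F.obj B :=
  (eHomEquiv SSet).symm (eHomEquiv SSet f ≫ F.map A B)

lemma onHom_id (F : EnrichedFunctor SSet.{v} K L) (A : K) : onHom F (𝟙 A) = 𝟙 (F.obj A) := by
  rw [onHom, eHomEquiv_id, F.map_id, Equiv.symm_apply_eq, eHomEquiv_id]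

lemma onHom_comp (F : EnrichedFunctor SSet.{v} K L) {A B C : K} (f : A ⟶ B) (g : B ⟶ C) :
    onHom F (f ≫ g) = onHom F f ≫ onHom F g := by
  rw [onHom, Equiv.symm_apply_eq, eHomEquiv_comp, eHomEquiv_comp]
  simp [onHom]

/-- The functor `h Fun(A, B) ⥤ h Fun(FA, FB)` induced by `F`. -/
abbrev onHomCat (F : EnrichedFunctor SSet.{v} K L) (A B : K) :
    (SSet.hoFunctor.obj (A ⟶[SSet.{v}] B)) ⥤ (SSet.hoFunctor.obj (F.obj A ⟶[SSet.{v}] F.obj B)) :=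
  (SSet.hoFunctor.map (F.map A B)).toFunctor

lemma homEquiv_onHom (F : EnrichedFunctor SSet.{v} K L) {A B : HomotopyTwoCategory K} (f : A ⟶ B) :
    CatEnrichedOrdinary.homEquiv (C := TransportEnrichment SSet.hoFunctor.{v} L)
      (a := F.obj A) (b := F.obj B) (onHom F f) =
      (onHomCat F A B).obj (CatEnrichedOrdinary.homEquiv f) := by
  change (SSet.hoFunctor.obj.equiv _).symm (SSet.unitHomEquiv _ (eHomEquiv SSet (onHom F f))) = _
  have h : eHomEquiv SSet.{v} (onHom (K := K) (L := L) F f) =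
      eHomEquiv SSet.{v} (C := K) f ≫ F.map A B := Equiv.apply_symm_apply _ _
  exact congrArg (fun x => (SSet.hoFunctor.obj.equiv _).symm (SSet.unitHomEquiv _ x)) h

lemma onHomCat_hComp (F : EnrichedFunctor SSet.{v} K L) (A B C : K) : 
   (eComp Cat.{v,v} (C := TransportEnrichment SSet.hoFunctor.{v} K) A B C).toFunctor ⋙ onHomCat F A C =
   (onHomCat F A B).prod (onHomCat F B C) ⋙ (eComp Cat.{v,v} (C := TransportEnrichment SSet.hoFunctor.{v} L) (F.obj A) (F.obj B) (F.obj C)).toFunctor := by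
  have h := F.map_comp A B C
  have h2 := congrArg SSet.hoFunctor.map h
  have h3 := congrArg (fun t => Functor.LaxMonoidal.μ SSet.hoFunctor.{v} _ _ ≫ t) h2
  simp only [Functor.map_comp, ← Functor.LaxMonoidal.μ_natural_assoc] at h3
  exact congrArg Cat.Hom.toFunctor h3

lemma onHomCat_map_hComp (F : EnrichedFunctor SSet.{v} K L)
    {A B C : CatEnriched (TransportEnrichment SSet.hoFunctor.{v} K)}
    {f f' : A ⟶ B} {g g' : B ⟶ C} (η : f ⟶ f') (θ : g ⟶ g') :
    HEq ((onHomCat F A C).map (CatEnriched.hComp η θ))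
      (CatEnriched.hComp (C := TransportEnrichment SSet.hoFunctor.{v} L)
        (a := F.obj A) (b := F.obj B) (c := F.obj C)
        ((onHomCat F A B).map η) ((onHomCat F B C).map θ)) :=
  congr_arg_heq (fun G => G.map (X := (f, g)) (Y := (f', g')) (η, θ)) (onHomCat_hComp F A B C)


/-- `F` on the objects of the homotopy 2-categories. -/
def twoObj (F : EnrichedFunctor SSet.{v} K L) (A : HomotopyTwoCategory K) :
    HomotopyTwoCategory L := F.obj A

/-- `F` on the 1-cells of the homotopy 2-categories. -/
def twoMap (F : EnrichedFunctor SSet.{v} K L) {A B : HomotopyTwoCategory K} (f : A ⟶ B) :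
    twoObj F A ⟶ twoObj F B := onHom F f

lemma twoMap_id (F : EnrichedFunctor SSet.{v} K L) (A : HomotopyTwoCategory K) :
    twoMap F (𝟙 A) = 𝟙 (twoObj F A) := onHom_id F A

lemma twoMap_comp (F : EnrichedFunctor SSet.{v} K L) {A B C : HomotopyTwoCategory K}
    (f : A ⟶ B) (g : B ⟶ C) : twoMap F (f ≫ g) = twoMap F f ≫ twoMap F g := onHom_comp F f g

/-- `onHomCat` as a functor between hom-categories. -/
def homFunctor (F : EnrichedFunctor SSet.{v} K L) (A B : HomotopyTwoCategory K) :
    (A.toBase ⟶ B.toBase) ⥤ ((twoObj F A).toBase ⟶ (twoObj F B).toBase) :=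
  onHomCat F A B

lemma homEquiv_twoMap (F : EnrichedFunctor SSet.{v} K L) {A B : HomotopyTwoCategory K}
    (f : A ⟶ B) : CatEnrichedOrdinary.homEquiv (twoMap F f) =
      (homFunctor F A B).obj (CatEnrichedOrdinary.homEquiv f) := homEquiv_onHom F f

lemma homFunctor_map_hComp (F : EnrichedFunctor SSet.{v} K L)
    {A B C : HomotopyTwoCategory K}
    {f f' : A.toBase ⟶ B.toBase} {g g' : B.toBase ⟶ C.toBase} (η : f ⟶ f') (θ : g ⟶ g') :
    HEq ((homFunctor F A C).map (CatEnriched.hComp η θ))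
      (CatEnriched.hComp ((homFunctor F A B).map η) ((homFunctor F B C).map θ)) :=
  onHomCat_map_hComp F η θ

open CatEnrichedOrdinary in
/-- `F` on the 2-cells of the homotopy 2-categories. -/
def twoMap₂ (F : EnrichedFunctor SSet.{v} K L) {A B : HomotopyTwoCategory K} {f g : A ⟶ B}
    (α : f ⟶ g) : twoMap F f ⟶ twoMap F g :=
  Hom.mk (eqToHom (homEquiv_twoMap F f) ≫ (homFunctor F A B).map (Hom.base α) ≫
    eqToHom (homEquiv_twoMap F g).symm)

lemma hComp_heq {C : Type*} [EnrichedCategory Cat C] {X Y Z : CatEnriched C} {f f₁ g g₁ : X ⟶ Y} {h h₁ k k₁ : Y ⟶ Z}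
   (ef : f = f₁) (eg : g = g₁) (eh : h = h₁) (ek : k = k₁) {η : f ⟶ g} {η₁ : f₁ ⟶ g₁} {θ : h ⟶ k} {θ₁ : h₁ ⟶ k₁}
   (e : HEq η η₁) (e' : HEq θ θ₁) : HEq (CatEnriched.hComp η θ) (CatEnriched.hComp η₁ θ₁) := by
  subst ef eg eh ek
  rw [eq_of_heq e, eq_of_heq e']

open CatEnrichedOrdinary in
lemma twoMap₂_hComp (F : EnrichedFunctor SSet.{v} K L) {A B C : HomotopyTwoCategory K}
    {f f' : A ⟶ B} {g g' : B ⟶ C} (η : f ⟶ f') (θ : g ⟶ g') :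
    twoMap₂ F (hComp η θ) = eqToHom (twoMap_comp F f g) ≫ hComp (twoMap₂ F η) (twoMap₂ F θ) ≫ 
      eqToHom (twoMap_comp F f' g').symm := by
  ext
  simp only [twoMap₂, hComp, base_mk, Hom.base_comp, Hom.base_eqToHom, Functor.map_comp, eqToHom_map,
    ← heq_eq_eq, eqToHom_comp_heq_iff, comp_eqToHom_heq_iff, heq_eqToHom_comp_iff, heq_comp_eqToHom_iff]
  refine (homFunctor_map_hComp F _ _).trans (hComp_heq ?_ ?_ ?_ ?_ ?_ ?_)
  · exact (homEquiv_twoMap F f).symm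
  · exact (homEquiv_twoMap F _).symm
  · exact (homEquiv_twoMap F _).symm
  · exact (homEquiv_twoMap F _).symm
  · simp
  · simp

open CatEnrichedOrdinary in
lemma twoMap₂_id (F : EnrichedFunctor SSet.{v} K L) {A B : HomotopyTwoCategory K}
    (f : A ⟶ B) : twoMap₂ F (𝟙 f) = 𝟙 (twoMap F f) := by
  ext
  simp [twoMap₂]

open CatEnrichedOrdinary in
lemma twoMap₂_comp (F : EnrichedFunctor SSet.{v} K L) {A B : HomotopyTwoCategory K}
    {f g h : A ⟶ B} (α : f ⟶ g) (β : g ⟶ h) :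
    twoMap₂ F (α ≫ β) = twoMap₂ F α ≫ twoMap₂ F β := by
  ext
  simp [twoMap₂]

/-- The 2-functor between homotopy 2-categories induced by a simplicial functor. -/
def homotopyTwoFunctor (F : EnrichedFunctor SSet.{v} K L) :
    StrictPseudofunctor (HomotopyTwoCategory K) (HomotopyTwoCategory L) :=
  .mk''
    { obj := twoObj F
      map := twoMap F
      map₂ := twoMap₂ F
      map₂_id := twoMap₂_id F
      map₂_comp := twoMap₂_comp F
      map_id := twoMap_id F
      map_comp := twoMap_comp F
      map₂_whisker_left := by
        intro a b c f g g' η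
        refine (twoMap₂_hComp F (𝟙 f) η).trans ?_
        rw [twoMap₂_id]; rfl
      map₂_whisker_right := by
        intro a b c f f' η g
        refine (twoMap₂_hComp F η (𝟙 g)).trans ?_
        rw [twoMap₂_id]; rfl }

end TwoFunctor

/-! ### Functors and weak equivalences of ∞-cosmoi -/

/-- A functor of ∞-cosmoi: a simplicial functor that preserves isofibrations, the terminal object,
cotensors, and pullbacks of isofibrations. -/
structure CosmosFunctor (K : Type u₁) [Category.{v} K] [SimplicialCategory K] [InfinityCosmos K]
    (L : Type u₂) [Category.{v} L] [SimplicialCategory L] [InfinityCosmos L]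
    extends EnrichedFunctor SSet.{v} K L where
  map_isofib : ∀ {A B : K} (p : A ⟶ B), InfinityCosmos.isofib p →
    InfinityCosmos.isofib (onHom toEnrichedFunctor p)
  map_terminal : ∀ T : K, IsSimplicialTerminal T → IsSimplicialTerminal (obj T)
  map_cotensor : ∀ {A P : K} {U : SSet.{v}} (η : U ⟶ (P ⟶[SSet.{v}] A)), IsCotensor η →
    IsCotensor (η ≫ map P A)
  map_pullback : ∀ {P E A B : K} (fst : P ⟶ E) (snd : P ⟶ A) (p : E ⟶ B) (f : A ⟶ B),
    InfinityCosmos.isofib p → IsSimplicialPullback fst snd p f →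
    IsSimplicialPullback (onHom toEnrichedFunctor fst) (onHom toEnrichedFunctor snd)
      (onHom toEnrichedFunctor p) (onHom toEnrichedFunctor f)

namespace CosmosFunctor

variable {K : Type u₁} [Category.{v} K] [SimplicialCategory K] [InfinityCosmos K]
  {L : Type u₂} [Category.{v} L] [SimplicialCategory L] [InfinityCosmos L]

/-- The image `Ff : FA ⟶ FB` of a functor `f : A ⟶ B`. -/
abbrev map₁ (F : CosmosFunctor K L) {A B : K} (f : A ⟶ B) : F.obj A ⟶ F.obj B :=
  onHom F.toEnrichedFunctor f

/-- The induced 2-functor `F₂` between homotopy 2-categories. -/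
abbrev twoFunctor (F : CosmosFunctor K L) :
    StrictPseudofunctor (HomotopyTwoCategory K) (HomotopyTwoCategory L) :=
  homotopyTwoFunctor F.toEnrichedFunctor

/-- A weak equivalence of ∞-cosmoi: surjective on objects up to equivalence, and a local
equivalence of mapping quasi-categories. -/
structure IsWeakEquivalence (F : CosmosFunctor K L) : Prop where
  surjective : ∀ X : L, ∃ A : K,
    AreEquivalent (𝓑 := HomotopyTwoCategory L) (F.obj A) X
  local_equivalence : ∀ A B : K, IsQCatEquivalence (F.map A B)

end CosmosFunctor

/-! ### Comma ∞-categories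

A morphism `E ⟶ C × B` is given by its components `E ⟶ C` and `E ⟶ B`. -/

section Comma

variable {K : Type u} [Category.{v} K] [SimplicialCategory K]

/-- The morphism `(q₁, q₀) : E ⟶ C × B` is an isofibration. -/
def IsIsofibrationSpan [InfinityCosmos K] {E C B : K} (q₁ : E ⟶ C) (q₀ : E ⟶ B) : Prop :=
  ∃ (CB : K) (π₁ : CB ⟶ C) (π₀ : CB ⟶ B) (q : E ⟶ CB), IsSimplicialProduct π₁ π₀ ∧
    q ≫ π₁ = q₁ ∧ q ≫ π₀ = q₀ ∧ InfinityCosmos.isofib q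

/-- For `η : Δ[1] ⟶ Fun(P, A)`, the morphism `P ⟶ A` that is the vertex `j` of `η`. -/
def arrowProjection {A P : K} (η : Δ[1] ⟶ (P ⟶[SSet.{v}] A)) (j : Fin 2) : P ⟶ A :=
  (SimplicialCategory.homEquiv' P A).symm (η.app _ (SSet.stdSimplex.obj₀Equiv.symm j))

/-- `P`, with `(p₁, p₀) : P ⟶ C × B`, is the comma ∞-category `f ↓ g` of `f : B ⟶ A` and
`g : C ⟶ A`: it is the pullback of `(p₁, p₀) : A^Δ[1] ⟶ A × A` along `g × f`. -/
def IsComma {A B C P : K} (f : B ⟶ A) (g : C ⟶ A) (p₁ : P ⟶ C) (p₀ : P ⟶ B) : Prop :=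
  ∃ (CB : K) (π₁ : CB ⟶ C) (π₀ : CB ⟶ B) (AA : K) (ρ₁ : AA ⟶ A) (ρ₀ : AA ⟶ A)
    (Arr : K) (η : Δ[1] ⟶ (Arr ⟶[SSet.{v}] A))
    (gf : CB ⟶ AA) (d : Arr ⟶ AA) (t : P ⟶ Arr) (p : P ⟶ CB),
    IsSimplicialProduct π₁ π₀ ∧ IsSimplicialProduct ρ₁ ρ₀ ∧ IsCotensor η ∧
    gf ≫ ρ₁ = π₁ ≫ g ∧ gf ≫ ρ₀ = π₀ ≫ f ∧
    d ≫ ρ₁ = arrowProjection η 1 ∧ d ≫ ρ₀ = arrowProjection η 0 ∧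
    IsSimplicialPullback t p d gf ∧ p ≫ π₁ = p₁ ∧ p ≫ π₀ = p₀

/-- `E ≃ P` over `C × B`: there is an equivalence `E ⟶ P` that commutes with the morphisms to
`C × B`. -/
def EquivalentOver {C B E P : K} (q₁ : E ⟶ C) (q₀ : E ⟶ B) (p₁ : P ⟶ C) (p₀ : P ⟶ B) : Prop :=
  ∃ e : E ⟶ P, IsEquivalence e ∧ e ≫ p₁ = q₁ ∧ e ≫ p₀ = q₀

end Comma

end InfCosmos

end

/-!
Write `f ∼ g` when two morphisms `A ⟶ B` of an ∞-cosmos are joined by a map `𝕀 ⟶ Fun(A, B)`.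

The homotopies of an ∞-cosmos compose (`IsoPath.trans`), and no theory of special outer horns is
needed for this. The evaluation `B^𝕀 ⟶ B × B` is an isofibration, as it is the Leibniz cotensor of
`B ⟶ 1` with the inclusion of the two vertices of `𝕀` (`isofib_of_vertices`). A homotopy `f ∼ g` is
a morphism `A ⟶ B^𝕀` over `(f, g)`, and lifting the homotopy `(f, g) ∼ (f, h)` along this
isofibration provides `f ∼ h`.

Hence the equivalences of an ∞-cosmos are the morphisms with an inverse up to `∼`
(`isEquivalence_iff_isHtpyEquiv`). As `Fun(A, B) ⟶ Fun(FA, FB)` is an equivalence, `F` reflects `∼`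
and every morphism `FA ⟶ FB` is homotopic to one in the image of `F`, so that `F` preserves and
reflects equivalences.

In the homotopy category of `S × 𝕀` the two copies of the homotopy category of `S` are naturally
isomorphic, so an equivalence of quasi-categories induces an equivalence of homotopy categories
(`isEquivalence_hoFunctor_map`). This makes `F₂` a biequivalence; the statements about isomorphism
classes, groupoidal objects and equivalences in the homotopy 2-categories hold for every
biequivalence.

The comma ∞-category is built from limits that `F` preserves (`IsComma.map`), because
`A^Δ[1] ⟶ A × A` is again an isofibration, and it is determined by its universal property
(`IsCommaCone.exists_iso`). To reflect equivalences over `C × B`, note that an equivalence `FE ⟶ F(f ↓ g)`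
over `FC × FB` is homotopic to the image of some `a : E ⟶ f ↓ g`. This `a` lies over `C × B` up to homotopy, and
lifting that homotopy along the isofibration `f ↓ g ⟶ C × B` replaces `a` by a homotopic morphism
strictly over `C × B` (`EquivalentOver.of_map`).
-/

namespace InfCosmos

/-! ### Vertices of mapping simplicial sets -/

lemma const_app_zero {S T : SSet.{v}} (x : S _⦋0⦌) (y : T _⦋0⦌) :
    (SSet.const y : S ⟶ T).app _ x = y := by
  simp [SSet.const]

lemma lift_comp_app {S T T' U : SSet.{v}} (f : S ⟶ T) (g : S ⟶ T') (h : T ⊗ T' ⟶ U)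
    (x : S _⦋0⦌) : (lift f g ≫ h).app _ x = h.app _ (f.app _ x, g.app _ x) := rfl

section Vertices

variable {K : Type u} [Category.{v} K] [SimplicialCategory K]

/-- The vertex of `Fun(A, B)` that corresponds to the morphism `f : A ⟶ B`. -/
abbrev vertex {A B : K} (f : A ⟶ B) : (A ⟶[SSet.{v}] B) _⦋0⦌ :=
  SimplicialCategory.homEquiv' A B f

lemma exists_vertex_eq {A B : K} (x : (A ⟶[SSet.{v}] B) _⦋0⦌) : ∃ f : A ⟶ B, vertex f = x :=
  (SimplicialCategory.homEquiv' A B).surjective x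

lemma eHomEquiv_eq_const {A B : K} (f : A ⟶ B) :
    eHomEquiv SSet.{v} f = SSet.const (vertex f) :=
  (SSet.unitHomEquiv _).injective (by
    refine Eq.trans ?_ (const_app_zero (S := 𝟙_ SSet.{v}) PUnit.unit (vertex f)).symm
    rfl)

lemma eHomWhiskerLeft_eq (X : K) {A B : K} (f : A ⟶ B) :
    eHomWhiskerLeft SSet.{v} X f =
      lift (𝟙 _) (SSet.const (vertex f)) ≫ eComp SSet.{v} X A B := by
  rw [eHomWhiskerLeft, eHomEquiv_eq_const]
  rfl

lemma eHomWhiskerRight_eq {A B : K} (f : A ⟶ B) (X : K) :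
    eHomWhiskerRight SSet.{v} f X =
      lift (SSet.const (vertex f)) (𝟙 _) ≫ eComp SSet.{v} A B X := by
  rw [eHomWhiskerRight, eHomEquiv_eq_const]
  rfl

lemma vertex_comp {A B C : K} (f : A ⟶ B) (g : B ⟶ C) :
    (eComp SSet.{v} A B C).app _ (vertex f, vertex g) = vertex (f ≫ g) := by
  have := congrArg (SSet.unitHomEquiv _) (eHomEquiv_comp SSet.{v} f g)
  rw [eHomEquiv_eq_const f, eHomEquiv_eq_const g] at this
  refine Eq.trans ?_ this.symm
  exact congrArg ((eComp SSet.{v} A B C).app _) (Prod.ext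
    (const_app_zero (S := 𝟙_ SSet.{v}) PUnit.unit (vertex f)).symm
    (const_app_zero (S := 𝟙_ SSet.{v}) PUnit.unit (vertex g)).symm)

lemma eHomWhiskerLeft_vertex (X : K) {A B : K} (f : X ⟶ A) (g : A ⟶ B) :
    (eHomWhiskerLeft SSet.{v} X g).app _ (vertex f) = vertex (f ≫ g) := by
  rw [eHomWhiskerLeft_eq, ← vertex_comp, lift_comp_app, const_app_zero]
  rfl

lemma eHomWhiskerRight_vertex {A B : K} (f : A ⟶ B) (X : K) (g : B ⟶ X) :
    (eHomWhiskerRight SSet.{v} f X).app _ (vertex g) = vertex (f ≫ g) := by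
  rw [eHomWhiskerRight_eq, ← vertex_comp, lift_comp_app, const_app_zero]
  rfl

end Vertices

section

variable {K : Type u₁} [Category.{v} K] [SimplicialCategory K]
  {L : Type u₂} [Category.{v} L] [SimplicialCategory L]

lemma map_vertex (F : EnrichedFunctor SSet.{v} K L) {A B : K} (f : A ⟶ B) :
    (F.map A B).app _ (vertex f) = vertex (onHom F f) := by
  simp [vertex, onHom, SimplicialCategory.homEquiv', SSet.unitHomEquiv]

end

/-! ### Paths -/

/-- Two vertices of a simplicial set are joined by a coherent isomorphism. -/
def IsoPath {S : SSet.{v}} (x y : S _⦋0⦌) : Prop :=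
  ∃ γ : SSet.coherentIso.{v} ⟶ S,
    γ.app _ SSet.coherentIso.x₀ = x ∧ γ.app _ SSet.coherentIso.x₁ = y

lemma IsoPath.refl {S : SSet.{v}} (x : S _⦋0⦌) : IsoPath x x :=
  ⟨SSet.const x, const_app_zero _ _, const_app_zero _ _⟩

/-- Paths are reversed by the involution of `𝕀`. -/
lemma IsoPath.symm {S : SSet.{v}} {x y : S _⦋0⦌} : IsoPath x y → IsoPath y x := by
  rintro ⟨γ, rfl, rfl⟩
  let s := nerveMap (WalkingIso.fromIso.{v} WalkingIso.iso.{v}.symm)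
  have h₀ : s.app _ SSet.coherentIso.x₀ = SSet.coherentIso.x₁ := ComposableArrows.ext₀ rfl
  have h₁ : s.app _ SSet.coherentIso.x₁ = SSet.coherentIso.x₀ := ComposableArrows.ext₀ rfl
  refine ⟨s ≫ γ, ?_, ?_⟩
  · rw [← h₀]; rfl
  · rw [← h₁]; rfl

lemma IsoPath.map {S T : SSet.{v}} {x y : S _⦋0⦌} (h : IsoPath x y) (f : S ⟶ T) :
    IsoPath (f.app _ x) (f.app _ y) := by
  obtain ⟨γ, rfl, rfl⟩ := h
  exact ⟨γ ≫ f, rfl, rfl⟩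

/-- A map out of `S ⊗ 𝕀` provides a path between the values of its two ends at a vertex. -/
lemma IsoPath.of_homotopy {S T : SSet.{v}} {h : S ⊗ SSet.coherentIso.{v} ⟶ T} {f g : S ⟶ T}
    (hf : lift (𝟙 S) (SSet.const SSet.coherentIso.x₀) ≫ h = f)
    (hg : lift (𝟙 S) (SSet.const SSet.coherentIso.x₁) ≫ h = g) (x : S _⦋0⦌) :
    IsoPath (f.app _ x) (g.app _ x) := by
  subst hf hg
  refine ⟨lift (SSet.const x) (𝟙 _) ≫ h, ?_, ?_⟩ <;>
    simp only [lift_comp_app, const_app_zero] <;> rfl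

/-! ### Universal properties of simplicially enriched limits -/

section UniversalProperties

variable {K : Type u} [Category.{v} K] [SimplicialCategory K]

lemma hom_ext_of_vertex {A B : K} {f g : A ⟶ B} (h : vertex f = vertex g) : f = g :=
  (SimplicialCategory.homEquiv' A B).injective h

/-- On `U ⊗ S`, the comparison map of a cotensor is the enriched composition. -/
lemma uncurry_comp_cotensorComparison {A P : K} {U : SSet.{v}} (η : U ⟶ (P ⟶[SSet.{v}] A))
    {X : K} {S : SSet.{v}} (k : S ⟶ (X ⟶[SSet.{v}] P)) :
    MonoidalClosed.uncurry (k ≫ cotensorComparison η X) =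
      lift (snd _ _ ≫ k) (fst _ _ ≫ η) ≫ eComp SSet.{v} X P A := by
  rw [MonoidalClosed.uncurry_natural_left, cotensorComparison, MonoidalClosed.uncurry_curry]
  rfl

/-- Evaluation at a vertex of `U` turns the comparison map of `A^U` into postcomposition with the
corresponding projection `A^U ⟶ A`. -/
lemma cotensorComparison_eval {A P : K} {U : SSet.{v}} (η : U ⟶ (P ⟶[SSet.{v}] A)) (X : K)
    (x : U _⦋0⦌) {f : P ⟶ A} (hf : η.app _ x = vertex f) :
    lift (SSet.const x) (𝟙 _) ≫ MonoidalClosed.uncurry (cotensorComparison η X) =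
      eHomWhiskerLeft SSet.{v} X f := by
  rw [← Category.id_comp (cotensorComparison η X), uncurry_comp_cotensorComparison,
    eHomWhiskerLeft_eq, ← hf]
  have : (SSet.const x : (X ⟶[SSet.{v}] P) ⟶ U) ≫ η = SSet.const (η.app _ x) := by simp
  rw [← this]
  rfl

lemma uncurry_eHomEquiv_comp_cotensorComparison {A P X : K} {U : SSet.{v}}
    (η : U ⟶ (P ⟶[SSet.{v}] A)) (h : X ⟶ P) :
    MonoidalClosed.uncurry (eHomEquiv SSet.{v} h ≫ cotensorComparison η X) =
      (ρ_ U).hom ≫ η ≫ eHomWhiskerRight SSet.{v} h A := by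
  rw [uncurry_comp_cotensorComparison, eHomWhiskerRight_eq, eHomEquiv_eq_const]
  rfl

lemma IsCotensor.exists_lift {A P : K} {U : SSet.{v}} {η : U ⟶ (P ⟶[SSet.{v}] A)}
    (hη : IsCotensor η) {X : K} (γ : U ⟶ (X ⟶[SSet.{v}] A)) :
    ∃ h : X ⟶ P, η ≫ eHomWhiskerRight SSet.{v} h A = γ := by
  have := hη X
  refine ⟨(eHomEquiv SSet.{v}).symm
    (MonoidalClosed.curry ((ρ_ U).hom ≫ γ) ≫ inv (cotensorComparison η X)), ?_⟩
  rw [← cancel_epi (ρ_ U).hom, ← uncurry_eHomEquiv_comp_cotensorComparison]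
  simp [MonoidalClosed.uncurry_curry]

lemma IsCotensor.hom_ext {A P : K} {U : SSet.{v}} {η : U ⟶ (P ⟶[SSet.{v}] A)}
    (hη : IsCotensor η) {X : K} {h h' : X ⟶ P}
    (e : η ≫ eHomWhiskerRight SSet.{v} h A = η ≫ eHomWhiskerRight SSet.{v} h' A) : h = h' := by
  have := hη X
  rw [← cancel_epi (ρ_ U).hom, ← uncurry_eHomEquiv_comp_cotensorComparison,
    ← uncurry_eHomEquiv_comp_cotensorComparison] at e
  exact (eHomEquiv SSet.{v}).injective
    ((cancel_mono (cotensorComparison η X)).1 (MonoidalClosed.uncurry_injective e))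

lemma IsSimplicialProduct.exists_lift {C B P : K} {π₁ : P ⟶ C} {π₀ : P ⟶ B}
    (h : IsSimplicialProduct π₁ π₀) {X : K} {S : SSet.{v}} (α : S ⟶ (X ⟶[SSet.{v}] C))
    (β : S ⟶ (X ⟶[SSet.{v}] B)) :
    ∃ w : S ⟶ (X ⟶[SSet.{v}] P), w ≫ eHomWhiskerLeft SSet.{v} X π₁ = α ∧
      w ≫ eHomWhiskerLeft SSet.{v} X π₀ = β := by
  obtain ⟨w, h₁, h₂⟩ := Limits.BinaryFan.IsLimit.lift' (h X).some α β
  exact ⟨w, h₁, h₂⟩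

lemma IsSimplicialProduct.hom_ext {C B P : K} {π₁ : P ⟶ C} {π₀ : P ⟶ B}
    (h : IsSimplicialProduct π₁ π₀) {X : K} {S : SSet.{v}} {w w' : S ⟶ (X ⟶[SSet.{v}] P)}
    (h₁ : w ≫ eHomWhiskerLeft SSet.{v} X π₁ = w' ≫ eHomWhiskerLeft SSet.{v} X π₁)
    (h₀ : w ≫ eHomWhiskerLeft SSet.{v} X π₀ = w' ≫ eHomWhiskerLeft SSet.{v} X π₀) : w = w' :=
  Limits.BinaryFan.IsLimit.hom_ext (h X).some h₁ h₀

lemma eHomEquiv_comp_whiskerLeft {X A B : K} (f : X ⟶ A) (g : A ⟶ B) :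
    eHomEquiv SSet.{v} f ≫ eHomWhiskerLeft SSet.{v} X g = eHomEquiv SSet.{v} (f ≫ g) := by
  rw [eHomEquiv_eq_const, eHomEquiv_eq_const, ← eHomWhiskerLeft_vertex]
  simp

lemma IsSimplicialProduct.exists_hom {C B P : K} {π₁ : P ⟶ C} {π₀ : P ⟶ B}
    (h : IsSimplicialProduct π₁ π₀) {X : K} (f : X ⟶ C) (g : X ⟶ B) :
    ∃ w : X ⟶ P, w ≫ π₁ = f ∧ w ≫ π₀ = g := by
  obtain ⟨w, h₁, h₂⟩ := h.exists_lift (eHomEquiv SSet.{v} f) (eHomEquiv SSet.{v} g)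
  obtain ⟨w, rfl⟩ := (eHomEquiv SSet.{v}).surjective w
  rw [eHomEquiv_comp_whiskerLeft] at h₁ h₂
  exact ⟨w, (eHomEquiv SSet.{v}).injective h₁, (eHomEquiv SSet.{v}).injective h₂⟩

lemma IsSimplicialProduct.ext {C B P : K} {π₁ : P ⟶ C} {π₀ : P ⟶ B}
    (h : IsSimplicialProduct π₁ π₀) {X : K} {w w' : X ⟶ P}
    (h₁ : w ≫ π₁ = w' ≫ π₁) (h₀ : w ≫ π₀ = w' ≫ π₀) : w = w' :=
  (eHomEquiv SSet.{v}).injective (h.hom_ext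
    (by rw [eHomEquiv_comp_whiskerLeft, eHomEquiv_comp_whiskerLeft, h₁])
    (by rw [eHomEquiv_comp_whiskerLeft, eHomEquiv_comp_whiskerLeft, h₀]))

lemma IsSimplicialPullback.w {P A B C : K} {fst : P ⟶ A} {snd : P ⟶ B} {f : A ⟶ C} {g : B ⟶ C}
    (h : IsSimplicialPullback fst snd f g) : fst ≫ f = snd ≫ g := by
  have := congrArg (fun t => eHomEquiv SSet.{v} (𝟙 P) ≫ t) (h P).w
  simp only [← eHomWhiskerLeft_comp, eHomEquiv_comp_whiskerLeft, Category.id_comp] at this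
  exact (eHomEquiv SSet.{v}).injective this

lemma IsSimplicialPullback.exists_hom {P A B C : K} {fst : P ⟶ A} {snd : P ⟶ B} {f : A ⟶ C}
    {g : B ⟶ C} (h : IsSimplicialPullback fst snd f g) {X : K} (a : X ⟶ A) (b : X ⟶ B)
    (w : a ≫ f = b ≫ g) : ∃ k : X ⟶ P, k ≫ fst = a ∧ k ≫ snd = b := by
  have e : eHomEquiv SSet.{v} a ≫ eHomWhiskerLeft SSet.{v} X f =
      eHomEquiv SSet.{v} b ≫ eHomWhiskerLeft SSet.{v} X g := by
    rw [eHomEquiv_comp_whiskerLeft, eHomEquiv_comp_whiskerLeft, w]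
  obtain ⟨k, h₁, h₂⟩ := (h X).exists_lift _ _ e
  obtain ⟨k, rfl⟩ := (eHomEquiv SSet.{v}).surjective k
  rw [eHomEquiv_comp_whiskerLeft] at h₁ h₂
  exact ⟨k, (eHomEquiv SSet.{v}).injective h₁, (eHomEquiv SSet.{v}).injective h₂⟩

lemma IsSimplicialPullback.ext {P A B C : K} {fst : P ⟶ A} {snd : P ⟶ B} {f : A ⟶ C}
    {g : B ⟶ C} (h : IsSimplicialPullback fst snd f g) {X : K} {k k' : X ⟶ P}
    (h₁ : k ≫ fst = k' ≫ fst) (h₂ : k ≫ snd = k' ≫ snd) : k = k' :=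
  (eHomEquiv SSet.{v}).injective ((h X).hom_ext
    (by rw [eHomEquiv_comp_whiskerLeft, eHomEquiv_comp_whiskerLeft, h₁])
    (by rw [eHomEquiv_comp_whiskerLeft, eHomEquiv_comp_whiskerLeft, h₂]))

lemma IsSimplicialTerminal.exists_hom {T : K} (hT : IsSimplicialTerminal T) (X : K) :
    Nonempty (X ⟶ T) :=
  ⟨(eHomEquiv SSet.{v}).symm ((hT X).some.from _)⟩

/-- A simplicially enriched product is a simplicially enriched pullback over a terminal object. -/
lemma isSimplicialPullback_terminal_iff {T : K} (hT : IsSimplicialTerminal T) {C B P : K}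
    (π₁ : P ⟶ C) (π₀ : P ⟶ B) (f : C ⟶ T) (g : B ⟶ T) :
    IsSimplicialPullback π₁ π₀ f g ↔ IsSimplicialProduct π₁ π₀ := by
  refine forall_congr' fun X => ⟨fun h => ⟨?_⟩, fun ⟨h⟩ => ?_⟩
  · refine Limits.BinaryFan.IsLimit.mk _ (fun α β => h.lift α β ((hT X).some.hom_ext _ _))
      (fun α β => h.lift_fst _ _ _) (fun α β => h.lift_snd _ _ _) fun α β m h₁ h₀ => ?_
    exact h.hom_ext (h₁.trans (h.lift_fst _ _ _).symm) (h₀.trans (h.lift_snd _ _ _).symm)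
  · rw [(hT X).some.hom_ext (eHomWhiskerLeft SSet.{v} X f) ((hT X).some.from _),
      (hT X).some.hom_ext (eHomWhiskerLeft SSet.{v} X g) ((hT X).some.from _)]
    exact IsPullback.of_is_product' h (hT X).some

end UniversalProperties

/-! ### Cotensors with two points -/

/-- The discrete simplicial set with two vertices. -/
abbrev twoPoint : SSet.{v} := (Functor.const _).obj (ULift Bool)

/-- The two vertices of the two-point simplicial set. -/
def twoPoint.pt (b : Bool) : twoPoint.{v} _⦋0⦌ := ULift.up b

/-- The map from the two-point simplicial set with prescribed images of the points. -/
def twoPointDesc {S : SSet.{v}} (x : Bool → S _⦋0⦌) : twoPoint.{v} ⟶ S where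
  app n := ↾fun b => (SSet.const (x b.down) : 𝟙_ SSet.{v} ⟶ S).app n PUnit.unit
  naturality n m f := by
    ext b
    exact ConcreteCategory.congr_hom
      ((SSet.const (x b.down) : 𝟙_ SSet.{v} ⟶ S).naturality f) PUnit.unit

lemma twoPointDesc_app {S : SSet.{v}} (x : Bool → S _⦋0⦌) (b : Bool) :
    (twoPointDesc x).app (Opposite.op ⦋0⦌) (twoPoint.pt b) = x b :=
  const_app_zero (S := 𝟙_ SSet.{v}) PUnit.unit (x b)

lemma twoPoint_tensor_hom_ext {S T : SSet.{v}} {f g : twoPoint.{v} ⊗ S ⟶ T}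
    (h : ∀ b : Bool, lift (SSet.const (twoPoint.pt b)) (𝟙 S) ≫ f =
      lift (SSet.const (twoPoint.pt b)) (𝟙 S) ≫ g) : f = g := by
  ext n ⟨⟨b⟩, s⟩
  exact ConcreteCategory.congr_hom (NatTrans.congr_app (h b) n) s

lemma twoPoint_hom_ext {T : SSet.{v}} {f g : twoPoint.{v} ⟶ T}
    (h : ∀ b : Bool,
      f.app (Opposite.op ⦋0⦌) (twoPoint.pt b) = g.app (Opposite.op ⦋0⦌) (twoPoint.pt b)) :
    f = g := by
  ext n ⟨b⟩
  have hf := NatTrans.naturality_apply f (SimplexCategory.const n.unop ⦋0⦌ 0).op (twoPoint.pt b)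
  have hg := NatTrans.naturality_apply g (SimplexCategory.const n.unop ⦋0⦌ 0).op (twoPoint.pt b)
  exact hf.trans ((congrArg _ (h b)).trans hg.symm)

/-- Each simplicial operator `⦋0⦌ ⟶ n` restricts an `n`-simplex of the image to its vertex, which
determines the point. -/
lemma mono_twoPointDesc {S : SSet.{v}} {x : Bool → S _⦋0⦌} (hx : Function.Injective x) :
    Mono (twoPointDesc x) := by
  have : ∀ n, Mono ((twoPointDesc x).app n) := by
    intro n
    rw [mono_iff_injective]
    rintro ⟨b⟩ ⟨b'⟩ h
    have h' := congrArg (S.map (SimplexCategory.const ⦋0⦌ n.unop 0).op) h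
    have hf := fun c => NatTrans.naturality_apply (twoPointDesc x)
      (SimplexCategory.const ⦋0⦌ n.unop 0).op (twoPoint.pt c)
    exact congrArg ULift.up (hx ((twoPointDesc_app x b).symm.trans
      ((hf b).trans (h'.trans ((hf b').symm.trans (twoPointDesc_app x b'))))))
  exact NatTrans.mono_of_mono_app _

section

variable {K : Type u} [Category.{v} K] [SimplicialCategory K]

/-- The square `A × A` is the cotensor of `A` by two points. -/
lemma IsSimplicialProduct.isCotensor {A P : K} {ρ : Bool → (P ⟶ A)}
    (h : IsSimplicialProduct (ρ true) (ρ false)) :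
    IsCotensor (twoPointDesc fun b => vertex (ρ b)) := by
  intro X
  -- The inverse of the comparison map has the evaluations at the two points as its components.
  set η := twoPointDesc fun b => vertex (ρ b)
  let ev (b : Bool) : (ihom twoPoint).obj (X ⟶[SSet.{v}] A) ⟶ (X ⟶[SSet.{v}] A) :=
    lift (SSet.const (twoPoint.pt b)) (𝟙 _) ≫ (ihom.ev _).app _
  have comp_ev {S : SSet.{v}} (k : S ⟶ (ihom twoPoint).obj (X ⟶[SSet.{v}] A)) (b : Bool) :
      k ≫ ev b = lift (SSet.const (twoPoint.pt b)) (𝟙 _) ≫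
        MonoidalClosed.uncurry k := by
    rw [MonoidalClosed.uncurry_eq]
    rfl
  have hev (b : Bool) : cotensorComparison η X ≫ ev b = eHomWhiskerLeft SSet.{v} X (ρ b) := by
    rw [comp_ev, cotensorComparison_eval η X (twoPoint.pt b) (twoPointDesc_app _ b)]
  obtain ⟨w, h₁, h₀⟩ := h.exists_lift (ev true) (ev false)
  refine ⟨w, h.hom_ext ?_ ?_, MonoidalClosed.uncurry_injective (twoPoint_tensor_hom_ext ?_)⟩
  · rw [Category.assoc, h₁, hev, Category.id_comp]
  · rw [Category.assoc, h₀, hev, Category.id_comp]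
  · intro b
    rw [← comp_ev, ← comp_ev, Category.assoc, hev, Category.id_comp]
    cases b
    exacts [h₀, h₁]

end

section Cosmos

variable {K : Type u} [Category.{v} K] [SimplicialCategory K] [InfinityCosmos K]

lemma exists_product (C B : K) :
    ∃ (P : K) (π₁ : P ⟶ C) (π₀ : P ⟶ B), IsSimplicialProduct π₁ π₀ := by
  obtain ⟨T, hT⟩ := InfinityCosmos.exists_terminal (K := K)
  obtain ⟨c⟩ := hT.exists_hom C
  obtain ⟨b⟩ := hT.exists_hom B
  obtain ⟨P, π₁, π₀, h⟩ :=
    InfinityCosmos.exists_pullback c b (InfinityCosmos.isofib_to_terminal c hT)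
  exact ⟨P, π₁, π₀, (isSimplicialPullback_terminal_iff hT π₁ π₀ c b).1 h⟩

/-- For distinct vertices `x₀`, `x₁` of `V`, evaluation at these vertices is an isofibration
`A^V ⟶ A × A`: it is the Leibniz cotensor of `A ⟶ 1` with the inclusion of the two points. -/
lemma isofib_of_vertices {V : SSet.{v}} {x : Bool → V _⦋0⦌} (hx : Function.Injective x)
    {A P Q : K} {η : V ⟶ (P ⟶[SSet.{v}] A)} (hη : IsCotensor η) {ρ : Bool → (Q ⟶ A)}
    (hρ : IsSimplicialProduct (ρ true) (ρ false)) {d : P ⟶ Q}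
    (hd : ∀ b, vertex (d ≫ ρ b) = η.app _ (x b)) : InfinityCosmos.isofib d := by
  obtain ⟨T, hT⟩ := InfinityCosmos.exists_terminal (K := K)
  obtain ⟨p⟩ := hT.exists_hom A
  obtain ⟨q⟩ := hT.exists_hom Q
  have hT' (X : K) {S : SSet.{v}} (f g : S ⟶ (X ⟶[SSet.{v}] T)) : f = g :=
    (hT X).some.hom_ext _ _
  have hTc {S : SSet.{v}} (η : S ⟶ (T ⟶[SSet.{v}] T)) : IsCotensor η := fun X =>
    ⟨(hT X).some.from _, hT' X _ _, MonoidalClosed.uncurry_injective (hT' X _ _)⟩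
  have hηQ := hρ.isCotensor
  -- With `B = T` terminal, `A^U ×_{T^U} T^V` is `A^U`, and `A^U` for the two points `U` is `Q`.
  refine InfinityCosmos.isofib_leibniz p (twoPointDesc x)
    (InfinityCosmos.isofib_to_terminal p hT) (mono_twoPointDesc hx) η
    (twoPointDesc fun b => vertex (ρ b)) ((hT T).some.from V) ((hT T).some.from twoPoint) hη hηQ
    (hTc _) (hTc _) q (𝟙 T) (hT' _ _ _) (hT' _ _ _) (𝟙 Q) q ?_ d ?_ (hT' _ _ _)
  · intro X
    rw [eHomWhiskerLeft_id, eHomWhiskerLeft_id]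
    exact IsPullback.of_horiz_isIso ⟨hT' _ _ _⟩
  · rw [IsCotensorMap, Category.comp_id, eHomWhiskerLeft_id, Category.comp_id]
    refine twoPoint_hom_ext fun b => ?_
    refine (congrArg (η.app _) (twoPointDesc_app x b)).trans ((hd b).symm.trans ?_)
    rw [← eHomWhiskerRight_vertex]
    exact congrArg ((eHomWhiskerRight SSet.{v} d A).app _)
      (twoPointDesc_app (fun b => vertex (ρ b)) b).symm

/-! ### Homotopies in an ∞-cosmos -/

lemma injective_coherentIso_vertices : Function.Injective
    (fun b : Bool => cond b SSet.coherentIso.x₁.{v} SSet.coherentIso.x₀) := by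
  have h : SSet.coherentIso.x₁.{v} ≠ SSet.coherentIso.x₀ := fun h =>
    absurd (congrArg (fun t : ComposableArrows WalkingIso.{v} 0 =>
      WalkingIso.equivBool (t.obj 0)) h) (by decide)
  rintro (_ | _) (_ | _) e
  · rfl
  · exact absurd e.symm h
  · exact absurd e h
  · rfl

lemma IsQCatIsofibration.exists_lift {S T : SSet.{v}} {p : S ⟶ T} (hp : IsQCatIsofibration p)
    (ε : SSet.coherentIso.{v} ⟶ T) (s : S _⦋0⦌)
    (h : ε.app _ SSet.coherentIso.x₀ = p.app _ s) :
    ∃ γ : SSet.coherentIso.{v} ⟶ S, γ ≫ p = ε ∧ γ.app _ SSet.coherentIso.x₀ = s := by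
  have := hp.lift_x₀
  have sq : CommSq (SSet.yonedaEquiv.symm s) (SSet.yonedaEquiv.symm SSet.coherentIso.x₀) p ε :=
    ⟨SSet.yonedaEquiv.injective (by simp [h])⟩
  refine ⟨sq.lift, sq.fac_right, ?_⟩
  exact SSet.yonedaEquiv.symm.injective
    ((SSet.yonedaEquiv_symm_comp _ _).symm.trans sq.fac_left)

/-- An isofibration lifts paths with prescribed starting point. -/
lemma exists_lift_isoPath {X E B : K} {p : E ⟶ B} (hp : InfinityCosmos.isofib p)
    (ε : SSet.coherentIso.{v} ⟶ (X ⟶[SSet.{v}] B)) (e : X ⟶ E)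
    (he : ε.app _ SSet.coherentIso.x₀ = vertex (e ≫ p)) :
    ∃ (e' : X ⟶ E), vertex (e' ≫ p) = ε.app _ SSet.coherentIso.x₁ ∧
      IsoPath (vertex e) (vertex e') := by
  obtain ⟨γ, rfl, hγ⟩ := (InfinityCosmos.isofib_hom X p hp).exists_lift ε (vertex e)
    (he.trans (eHomWhiskerLeft_vertex X e p).symm)
  obtain ⟨e', he'⟩ := exists_vertex_eq (γ.app _ SSet.coherentIso.x₁)
  refine ⟨e', ?_, γ, hγ, he'.symm⟩
  rw [← eHomWhiskerLeft_vertex, he']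
  rfl

/-- Homotopies in an ∞-cosmos compose: a homotopy `f ∼ g` is a morphism `X ⟶ A^𝕀` over
`(f, g) : X ⟶ A × A`, and the path `(f, g) ∼ (f, h)` lifts along the isofibration
`A^𝕀 ⟶ A × A`. -/
lemma IsoPath.trans {X A : K} {x y z : (X ⟶[SSet.{v}] A) _⦋0⦌} :
    IsoPath x y → IsoPath y z → IsoPath x z := by
  rintro ⟨γ, rfl, rfl⟩ ⟨δ, hδ, rfl⟩
  obtain ⟨P, η, hη⟩ := InfinityCosmos.exists_cotensor A SSet.coherentIso.{v}
  obtain ⟨Q, ρ₁, ρ₀, hρ⟩ := exists_product A A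
  obtain ⟨a₀, h₀⟩ := exists_vertex_eq (η.app _ SSet.coherentIso.x₀)
  obtain ⟨a₁, h₁⟩ := exists_vertex_eq (η.app _ SSet.coherentIso.x₁)
  obtain ⟨d, rfl, rfl⟩ := hρ.exists_hom a₁ a₀
  have hd : InfinityCosmos.isofib d :=
    isofib_of_vertices (ρ := fun b => cond b ρ₁ ρ₀) injective_coherentIso_vertices hη hρ (by
      rintro (_ | _)
      exacts [h₀, h₁])
  -- The path that corresponds to `k : X ⟶ A^𝕀` has as vertices the composites of `k` with the
  -- evaluations.
  have key (k : X ⟶ P) {i : SSet.coherentIso.{v} _⦋0⦌} {a : P ⟶ A} (ha : vertex a = η.app _ i) :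
      (η ≫ eHomWhiskerRight SSet.{v} k A).app _ i = vertex (k ≫ a) := by
    rw [← eHomWhiskerRight_vertex, ha]
    rfl
  obtain ⟨k, rfl⟩ := hη.exists_lift γ
  -- `ε` is the path `(f, g) ∼ (f, h)` in `Fun(X, A × A)`; it starts at the image of `k`.
  obtain ⟨ε, hε₁, hε₀⟩ := hρ.exists_lift δ (SSet.const (vertex (k ≫ d ≫ ρ₀)))
  obtain ⟨e, he⟩ := exists_vertex_eq (ε.app _ SSet.coherentIso.x₀)
  have he' : e = k ≫ d := by
    refine hρ.ext (hom_ext_of_vertex ?_) (hom_ext_of_vertex ?_)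
    · rw [← eHomWhiskerLeft_vertex, he, Category.assoc, ← key k h₁, ← hδ, ← hε₁]
      rfl
    · rw [← eHomWhiskerLeft_vertex, he, Category.assoc]
      exact (congrArg (fun t => t.app _ SSet.coherentIso.x₀) hε₀).trans (const_app_zero _ _)
  obtain ⟨k', hk', -⟩ := exists_lift_isoPath hd ε k (by rw [← he, he'])
  refine ⟨η ≫ eHomWhiskerRight SSet.{v} k' A, ?_, ?_⟩
  · rw [key k' h₀, key k h₀, ← Category.assoc, ← eHomWhiskerLeft_vertex, hk']
    exact (congrArg (fun t => t.app _ SSet.coherentIso.x₁) hε₀).trans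
      (const_app_zero _ _)
  · rw [key k' h₁, ← Category.assoc, ← eHomWhiskerLeft_vertex, hk', ← hε₁]
    rfl

end Cosmos

/-! ### Homotopy equivalences -/

section

variable {K : Type u} [Category.{v} K] [SimplicialCategory K]

/-- Two morphisms `A ⟶ B` are homotopic if they are joined by a map `𝕀 ⟶ Fun(A, B)`. -/
def Htpy {A B : K} (f g : A ⟶ B) : Prop := IsoPath (vertex f) (vertex g)

lemma Htpy.refl {A B : K} (f : A ⟶ B) : Htpy f f := IsoPath.refl _

lemma Htpy.symm {A B : K} {f g : A ⟶ B} (h : Htpy f g) : Htpy g f := IsoPath.symm h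

lemma Htpy.comp_right {A B C : K} {f f' : A ⟶ B} (h : Htpy f f') (g : B ⟶ C) :
    Htpy (f ≫ g) (f' ≫ g) := by
  have := IsoPath.map h (eHomWhiskerLeft SSet.{v} A g)
  rwa [eHomWhiskerLeft_vertex, eHomWhiskerLeft_vertex] at this

lemma Htpy.comp_left {A B C : K} (f : A ⟶ B) {g g' : B ⟶ C} (h : Htpy g g') :
    Htpy (f ≫ g) (f ≫ g') := by
  have := IsoPath.map h (eHomWhiskerRight SSet.{v} f C)
  rwa [eHomWhiskerRight_vertex, eHomWhiskerRight_vertex] at this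

/-- A morphism is a homotopy equivalence if it has an inverse up to homotopy. -/
def IsHtpyEquiv {A B : K} (f : A ⟶ B) : Prop :=
  ∃ g : B ⟶ A, Htpy (𝟙 A) (f ≫ g) ∧ Htpy (g ≫ f) (𝟙 B)

lemma IsHtpyEquiv.of_iso {A B : K} (e : A ≅ B) : IsHtpyEquiv e.hom :=
  ⟨e.inv, by simpa using Htpy.refl (𝟙 A), by simpa using Htpy.refl (𝟙 B)⟩

/-- The end at `i` of the family of maps `Fun(X, A) ⟶ Fun(X, B)` parametrized by
`γ : S ⟶ Fun(A, B)`. -/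
lemma lift_const_whiskerLeft_eComp (X : K) {A B : K} {S : SSet.{v}} (γ : S ⟶ (A ⟶[SSet.{v}] B))
    (i : S _⦋0⦌) {k : A ⟶ B} (hk : γ.app _ i = vertex k) :
    lift (𝟙 (X ⟶[SSet.{v}] A)) (SSet.const i) ≫ (X ⟶[SSet.{v}] A) ◁ γ ≫ eComp SSet.{v} X A B =
      eHomWhiskerLeft SSet.{v} X k := by
  have : (SSet.const i : (X ⟶[SSet.{v}] A) ⟶ S) ≫ γ = SSet.const (γ.app _ i) := by simp
  rw [eHomWhiskerLeft_eq, ← hk, ← this]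
  rfl

/-- The homotopies `𝕀 ⟶ Fun(A, A)` and `𝕀 ⟶ Fun(B, B)` act on `Fun(X, A)` and `Fun(X, B)` by
composition. -/
lemma IsHtpyEquiv.isEquivalence {A B : K} {f : A ⟶ B} (h : IsHtpyEquiv f) : IsEquivalence f := by
  obtain ⟨g, ⟨γ, hγ₀, hγ₁⟩, δ, hδ₀, hδ₁⟩ := h
  refine fun X => ⟨eHomWhiskerLeft SSet.{v} X g, _ ◁ γ ≫ eComp SSet.{v} X A A,
    _ ◁ δ ≫ eComp SSet.{v} X B B, ?_, ?_, ?_, ?_⟩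
  · rw [lift_const_whiskerLeft_eComp X γ _ hγ₀, eHomWhiskerLeft_id]
  · rw [lift_const_whiskerLeft_eComp X γ _ hγ₁, eHomWhiskerLeft_comp]
  · rw [lift_const_whiskerLeft_eComp X δ _ hδ₀, eHomWhiskerLeft_comp]
  · rw [lift_const_whiskerLeft_eComp X δ _ hδ₁, eHomWhiskerLeft_id]

end

section

variable {K : Type u} [Category.{v} K] [SimplicialCategory K] [InfinityCosmos K]

lemma Htpy.trans {A B : K} {f g h : A ⟶ B} (h₁ : Htpy f g) (h₂ : Htpy g h) : Htpy f h :=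
  IsoPath.trans h₁ h₂

/-- In an ∞-cosmos, an equivalence of quasi-categories out of a mapping space reflects homotopies
between morphisms. -/
lemma Htpy.of_isQCatEquivalence {A B : K} {T : SSet.{v}} {φ : (A ⟶[SSet.{v}] B) ⟶ T}
    (hφ : IsQCatEquivalence φ) {f g : A ⟶ B}
    (h : IsoPath (φ.app _ (vertex f)) (φ.app _ (vertex g))) : Htpy f g := by
  obtain ⟨ψ, η, -, h₀, h₁, -, -⟩ := hφ
  have key (f : A ⟶ B) : IsoPath (vertex f) (ψ.app _ (φ.app _ (vertex f))) :=
    IsoPath.of_homotopy h₀ h₁ (vertex f)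
  exact ((key f).trans (h.map ψ)).trans (key g).symm

lemma exists_isoPath_of_isQCatEquivalence {S T : SSet.{v}} {φ : S ⟶ T}
    (hφ : IsQCatEquivalence φ) (y : T _⦋0⦌) : ∃ x : S _⦋0⦌, IsoPath (φ.app _ x) y := by
  obtain ⟨ψ, -, η, -, -, h₀, h₁⟩ := hφ
  exact ⟨ψ.app _ y, IsoPath.of_homotopy h₀ h₁ y⟩

/-- The equivalences of an ∞-cosmos are the homotopy equivalences. Given an equivalence
`f : A ⟶ B`, the inverse `g` is the image of `𝟙 B` under an inverse of `Fun(B, f)`, and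
`Fun(A, f)` reflects the homotopy between `f ≫ g ≫ f` and `f`. -/
lemma isEquivalence_iff_isHtpyEquiv {A B : K} {f : A ⟶ B} :
    IsEquivalence f ↔ IsHtpyEquiv f := by
  refine ⟨fun h => ?_, IsHtpyEquiv.isEquivalence⟩
  obtain ⟨x, hx⟩ := exists_isoPath_of_isQCatEquivalence (h B) (vertex (𝟙 B))
  obtain ⟨g, rfl⟩ := exists_vertex_eq x
  rw [eHomWhiskerLeft_vertex] at hx
  refine ⟨g, Htpy.of_isQCatEquivalence (h A) ?_, hx⟩
  rw [eHomWhiskerLeft_vertex, eHomWhiskerLeft_vertex]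
  simpa [Htpy] using (Htpy.comp_left f hx).symm

lemma IsHtpyEquiv.congr {A B : K} {f f' : A ⟶ B} (h : IsHtpyEquiv f) (hf : Htpy f f') :
    IsHtpyEquiv f' := by
  obtain ⟨g, h₁, h₂⟩ := h
  exact ⟨g, h₁.trans (hf.comp_right g), (hf.symm.comp_left g).trans h₂⟩

lemma IsHtpyEquiv.comp {A B C : K} {f : A ⟶ B} {f' : B ⟶ C} (h : IsHtpyEquiv f)
    (h' : IsHtpyEquiv f') : IsHtpyEquiv (f ≫ f') := by
  obtain ⟨g, h₁, h₂⟩ := h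
  obtain ⟨g', h₁', h₂'⟩ := h'
  refine ⟨g' ≫ g, h₁.trans ?_, Htpy.trans ?_ h₂'⟩
  · simpa using (h₁'.comp_right g).comp_left f
  · simpa using (h₂.comp_right f').comp_left g'

end

/-! ### Weak equivalences of ∞-cosmoi and homotopies -/

section

variable {K : Type u₁} [Category.{v} K] [SimplicialCategory K] [InfinityCosmos K]
  {L : Type u₂} [Category.{v} L] [SimplicialCategory L] [InfinityCosmos L]
  {F : CosmosFunctor K L}

lemma Htpy.map (F : CosmosFunctor K L) {A B : K} {f g : A ⟶ B} (h : Htpy f g) :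
    Htpy (F.map₁ f) (F.map₁ g) := by
  have := IsoPath.map h (F.map A B)
  rwa [map_vertex, map_vertex] at this

namespace CosmosFunctor.IsWeakEquivalence

lemma htpy_of_map (hF : F.IsWeakEquivalence) {A B : K} {f g : A ⟶ B}
    (h : Htpy (F.map₁ f) (F.map₁ g)) : Htpy f g :=
  Htpy.of_isQCatEquivalence (hF.local_equivalence A B) (by rwa [map_vertex, map_vertex])

lemma exists_htpy_map (hF : F.IsWeakEquivalence) {A B : K} (g : F.obj A ⟶ F.obj B) :
    ∃ f : A ⟶ B, Htpy (F.map₁ f) g := by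
  obtain ⟨x, hx⟩ := exists_isoPath_of_isQCatEquivalence (hF.local_equivalence A B) (vertex g)
  obtain ⟨f, rfl⟩ := exists_vertex_eq x
  rw [map_vertex] at hx
  exact ⟨f, hx⟩

lemma isHtpyEquiv_map_iff (hF : F.IsWeakEquivalence) {A B : K} {f : A ⟶ B} :
    IsHtpyEquiv (F.map₁ f) ↔ IsHtpyEquiv f := by
  constructor
  · rintro ⟨g', h₁, h₂⟩
    obtain ⟨g, hg⟩ := hF.exists_htpy_map g'
    refine ⟨g, hF.htpy_of_map ?_, hF.htpy_of_map ?_⟩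
    · rw [CosmosFunctor.map₁, CosmosFunctor.map₁, onHom_id, onHom_comp]
      exact h₁.trans (hg.symm.comp_left _)
    · rw [CosmosFunctor.map₁, CosmosFunctor.map₁, onHom_id, onHom_comp]
      exact (hg.comp_right _).trans h₂
  · rintro ⟨g, h₁, h₂⟩
    refine ⟨F.map₁ g, ?_, ?_⟩
    · simpa [CosmosFunctor.map₁, onHom_id, onHom_comp] using h₁.map F
    · simpa [CosmosFunctor.map₁, onHom_id, onHom_comp] using h₂.map F

lemma isEquivalence_map_iff (hF : F.IsWeakEquivalence) {A B : K} (f : A ⟶ B) :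
    IsEquivalence f ↔ IsEquivalence (F.map₁ f) := by
  rw [isEquivalence_iff_isHtpyEquiv, isEquivalence_iff_isHtpyEquiv, hF.isHtpyEquiv_map_iff]

end CosmosFunctor.IsWeakEquivalence

end

/-! ### Comma ∞-categories -/

section

variable {K : Type u} [Category.{v} K] [SimplicialCategory K]

lemma vertex_arrowProjection {A P : K} (η : Δ[1] ⟶ (P ⟶[SSet.{v}] A)) (j : Fin 2) :
    vertex (arrowProjection η j) = η.app _ (SSet.stdSimplex.obj₀Equiv.symm j) :=
  Equiv.apply_symm_apply _ _

lemma arrowProjection_comp_eHomWhiskerRight {A P X : K} (η : Δ[1] ⟶ (P ⟶[SSet.{v}] A))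
    (w : X ⟶ P) (j : Fin 2) :
    arrowProjection (η ≫ eHomWhiskerRight SSet.{v} w A) j = w ≫ arrowProjection η j := by
  apply hom_ext_of_vertex
  rw [vertex_arrowProjection, ← eHomWhiskerRight_vertex, vertex_arrowProjection]
  rfl

/-- The 1-categorical universal property of the comma ∞-category: a morphism `X ⟶ f ↓ g`
amounts to morphisms `u : X ⟶ C` and `v : X ⟶ B` with a 1-simplex of `Fun(X, A)` from
`v ≫ f` to `u ≫ g`. -/
structure IsCommaCone {A B C P : K} (f : B ⟶ A) (g : C ⟶ A) (p₁ : P ⟶ C) (p₀ : P ⟶ B)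
    (τ : Δ[1] ⟶ (P ⟶[SSet.{v}] A)) : Prop where
  w₀ : arrowProjection τ 0 = p₀ ≫ f
  w₁ : arrowProjection τ 1 = p₁ ≫ g
  exists_lift : ∀ {X : K} (u : X ⟶ C) (v : X ⟶ B) (σ : Δ[1] ⟶ (X ⟶[SSet.{v}] A)),
    arrowProjection σ 0 = v ≫ f → arrowProjection σ 1 = u ≫ g →
    ∃ w : X ⟶ P, w ≫ p₁ = u ∧ w ≫ p₀ = v ∧ τ ≫ eHomWhiskerRight SSet.{v} w A = σ
  hom_ext : ∀ {X : K} {w w' : X ⟶ P}, w ≫ p₁ = w' ≫ p₁ → w ≫ p₀ = w' ≫ p₀ →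
    τ ≫ eHomWhiskerRight SSet.{v} w A = τ ≫ eHomWhiskerRight SSet.{v} w' A → w = w'

lemma IsComma.exists_isCommaCone {A B C P : K} {f : B ⟶ A} {g : C ⟶ A} {p₁ : P ⟶ C}
    {p₀ : P ⟶ B} (h : IsComma f g p₁ p₀) : ∃ τ, IsCommaCone f g p₁ p₀ τ := by
  obtain ⟨CB, π₁, π₀, AA, ρ₁, ρ₀, Arr, η, gf, d, t, p, hπ, hρ, hη, hgf₁, hgf₀, hd₁, hd₀, hP,
    rfl, rfl⟩ := h
  refine ⟨η ≫ eHomWhiskerRight SSet.{v} t A, ?_, ?_, ?_, ?_⟩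
  · rw [arrowProjection_comp_eHomWhiskerRight, ← hd₀, ← Category.assoc, hP.w, Category.assoc,
      hgf₀, Category.assoc]
  · rw [arrowProjection_comp_eHomWhiskerRight, ← hd₁, ← Category.assoc, hP.w, Category.assoc,
      hgf₁, Category.assoc]
  · intro X u v σ h₀ h₁
    obtain ⟨s, rfl⟩ := hη.exists_lift σ
    rw [arrowProjection_comp_eHomWhiskerRight] at h₀ h₁
    obtain ⟨b, rfl, rfl⟩ := hπ.exists_hom u v
    obtain ⟨w, rfl, rfl⟩ := hP.exists_hom s b (hρ.ext
      (by rw [Category.assoc, Category.assoc, hd₁, h₁, hgf₁, Category.assoc])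
      (by rw [Category.assoc, Category.assoc, hd₀, h₀, hgf₀, Category.assoc]))
    exact ⟨w, by simp, by simp, by simp⟩
  · intro X w w' h₁ h₀ h
    refine hP.ext (hη.hom_ext ?_) (hπ.ext ?_ ?_)
    · simpa using h
    · simpa using h₁
    · simpa using h₀

lemma IsCommaCone.exists_iso {A B C P P' : K} {f : B ⟶ A} {g : C ⟶ A} {p₁ : P ⟶ C}
    {p₀ : P ⟶ B} {τ : Δ[1] ⟶ (P ⟶[SSet.{v}] A)} {p₁' : P' ⟶ C}
    {p₀' : P' ⟶ B} {τ' : Δ[1] ⟶ (P' ⟶[SSet.{v}] A)} (h : IsCommaCone f g p₁ p₀ τ)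
    (h' : IsCommaCone f g p₁' p₀' τ') :
    ∃ e : P' ≅ P, e.hom ≫ p₁ = p₁' ∧ e.hom ≫ p₀ = p₀' := by
  obtain ⟨a, ha₁, ha₀, ha⟩ := h.exists_lift p₁' p₀' τ' h'.w₀ h'.w₁
  obtain ⟨b, hb₁, hb₀, hb⟩ := h'.exists_lift p₁ p₀ τ h.w₀ h.w₁
  refine ⟨⟨a, b, h'.hom_ext ?_ ?_ ?_, h.hom_ext ?_ ?_ ?_⟩, ha₁, ha₀⟩
  · simp [ha₁, hb₁]
  · simp [ha₀, hb₀]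
  · rw [eHomWhiskerRight_comp, ← Category.assoc, hb, ha]
    simp
  · simp [ha₁, hb₁]
  · simp [ha₀, hb₀]
  · rw [eHomWhiskerRight_comp, ← Category.assoc, ha, hb]
    simp

end

/-- The map `A^Δ[1] ⟶ A × A` is an isofibration. -/
lemma isofib_arrow {K : Type u} [Category.{v} K] [SimplicialCategory K] [InfinityCosmos K]
    {A AA Arr : K} {ρ₁ ρ₀ : AA ⟶ A} (hρ : IsSimplicialProduct ρ₁ ρ₀)
    {η : Δ[1] ⟶ (Arr ⟶[SSet.{v}] A)} (hη : IsCotensor η) {d : Arr ⟶ AA}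
    (h₁ : d ≫ ρ₁ = arrowProjection η 1) (h₀ : d ≫ ρ₀ = arrowProjection η 0) :
    InfinityCosmos.isofib d := by
  refine isofib_of_vertices (x := fun b => SSet.stdSimplex.obj₀Equiv.symm (cond b 1 0))
    (SSet.stdSimplex.obj₀Equiv.symm.injective.comp (by decide)) hη
    (ρ := fun b => cond b ρ₁ ρ₀) hρ ?_
  rintro (_ | _)
  · exact (congrArg vertex h₀).trans (vertex_arrowProjection η 0)
  · exact (congrArg vertex h₁).trans (vertex_arrowProjection η 1)

section

variable {K : Type u₁} [Category.{v} K] [SimplicialCategory K] [InfinityCosmos K]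
  {L : Type u₂} [Category.{v} L] [SimplicialCategory L] [InfinityCosmos L]
  (F : CosmosFunctor K L)

lemma IsSimplicialProduct.map {C B P : K} {π₁ : P ⟶ C} {π₀ : P ⟶ B}
    (h : IsSimplicialProduct π₁ π₀) : IsSimplicialProduct (F.map₁ π₁) (F.map₁ π₀) := by
  obtain ⟨T, hT⟩ := InfinityCosmos.exists_terminal (K := K)
  obtain ⟨c⟩ := hT.exists_hom C
  obtain ⟨b⟩ := hT.exists_hom B
  exact (isSimplicialPullback_terminal_iff (F.map_terminal T hT) _ _ (F.map₁ c) (F.map₁ b)).1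
    (F.map_pullback _ _ _ _ (InfinityCosmos.isofib_to_terminal c hT)
      ((isSimplicialPullback_terminal_iff hT π₁ π₀ c b).2 h))

lemma arrowProjection_map {A P : K} (η : Δ[1] ⟶ (P ⟶[SSet.{v}] A)) (j : Fin 2) :
    arrowProjection (η ≫ F.map P A) j = F.map₁ (arrowProjection η j) := by
  apply hom_ext_of_vertex
  rw [vertex_arrowProjection, ← map_vertex, vertex_arrowProjection]
  rfl

lemma IsComma.map {A B C P : K} {f : B ⟶ A} {g : C ⟶ A} {p₁ : P ⟶ C}
    {p₀ : P ⟶ B} (h : IsComma f g p₁ p₀) :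
    IsComma (F.map₁ f) (F.map₁ g) (F.map₁ p₁) (F.map₁ p₀) := by
  obtain ⟨CB, π₁, π₀, AA, ρ₁, ρ₀, Arr, η, gf, d, t, p, hπ, hρ, hη, hgf₁, hgf₀, hd₁, hd₀, hP,
    rfl, rfl⟩ := h
  refine ⟨_, _, _, _, _, _, _, η ≫ F.map Arr A, F.map₁ gf, F.map₁ d, F.map₁ t, F.map₁ p,
    hπ.map F, hρ.map F, F.map_cotensor η hη, ?_, ?_, ?_, ?_,
    F.map_pullback t p d gf (isofib_arrow hρ hη hd₁ hd₀) hP, ?_, ?_⟩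
  · rw [← onHom_comp, hgf₁, onHom_comp]
  · rw [← onHom_comp, hgf₀, onHom_comp]
  · rw [← onHom_comp, hd₁, arrowProjection_map]
  · rw [← onHom_comp, hd₀, arrowProjection_map]
  · rw [← onHom_comp]
  · rw [← onHom_comp]

/-- The comma ∞-category is fibered: its projection to `C × B` is a pullback of the isofibration
`A^Δ[1] ⟶ A × A`. -/
lemma IsComma.isIsofibrationSpan {A B C P : K} {f : B ⟶ A} {g : C ⟶ A} {p₁ : P ⟶ C}
    {p₀ : P ⟶ B} (h : IsComma f g p₁ p₀) : IsIsofibrationSpan p₁ p₀ := by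
  obtain ⟨CB, π₁, π₀, AA, ρ₁, ρ₀, Arr, η, gf, d, t, p, hπ, hρ, hη, hgf₁, hgf₀, hd₁, hd₀, hP,
    hp₁, hp₀⟩ := h
  exact ⟨CB, π₁, π₀, p, hπ, hp₁, hp₀,
    InfinityCosmos.isofib_pullback t p d gf hP (isofib_arrow hρ hη hd₁ hd₀)⟩

variable {F}

lemma EquivalentOver.map (hF : F.IsWeakEquivalence) {C B E P : K} {q₁ : E ⟶ C} {q₀ : E ⟶ B}
    {p₁ : P ⟶ C} {p₀ : P ⟶ B} (h : EquivalentOver q₁ q₀ p₁ p₀) :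
    EquivalentOver (F.map₁ q₁) (F.map₁ q₀) (F.map₁ p₁) (F.map₁ p₀) := by
  obtain ⟨e, he, rfl, rfl⟩ := h
  exact ⟨F.map₁ e, (hF.isEquivalence_map_iff e).1 he, (onHom_comp _ _ _).symm,
    (onHom_comp _ _ _).symm⟩

/-- Equivalences over a base are reflected when the codomain is fibered over the base: a
preimage `a : E ⟶ P` of the equivalence up to homotopy lies over the base up to homotopy, and
is corrected by lifting this homotopy along the isofibration `P ⟶ C × B`. -/
lemma EquivalentOver.of_map (hF : F.IsWeakEquivalence) {C B E P : K} {q₁ : E ⟶ C} {q₀ : E ⟶ B}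
    {p₁ : P ⟶ C} {p₀ : P ⟶ B} (hp : IsIsofibrationSpan p₁ p₀)
    (h : EquivalentOver (F.map₁ q₁) (F.map₁ q₀) (F.map₁ p₁) (F.map₁ p₀)) :
    EquivalentOver q₁ q₀ p₁ p₀ := by
  obtain ⟨CB, π₁, π₀, p, hπ, rfl, rfl, hp⟩ := hp
  obtain ⟨q, rfl, rfl⟩ := hπ.exists_hom q₁ q₀
  obtain ⟨e, he, h₁, h₀⟩ := h
  obtain ⟨a, ha⟩ := hF.exists_htpy_map e
  have hpq : e ≫ F.map₁ p = F.map₁ q := (hπ.map F).ext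
    (by simpa [CosmosFunctor.map₁, onHom_comp] using h₁)
    (by simpa [CosmosFunctor.map₁, onHom_comp] using h₀)
  have hq : Htpy (a ≫ p) q := by
    apply hF.htpy_of_map
    rw [← hpq, CosmosFunctor.map₁, onHom_comp]
    exact ha.comp_right _
  obtain ⟨ε, hε₀, hε₁⟩ := hq
  obtain ⟨a', ha', haa'⟩ := exists_lift_isoPath hp ε a hε₀
  have ha'q : a' ≫ p = q := hom_ext_of_vertex (ha'.trans hε₁)
  refine ⟨a', ?_, by rw [← ha'q, Category.assoc], by rw [← ha'q, Category.assoc]⟩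
  rw [isEquivalence_iff_isHtpyEquiv, ← hF.isHtpyEquiv_map_iff]
  exact (isEquivalence_iff_isHtpyEquiv.1 he).congr (ha.symm.trans (Htpy.map F haa'))

lemma EquivalentOver.comp_iso {C B E P P' : K} {q₁ : E ⟶ C} {q₀ : E ⟶ B}
    {p₁ : P ⟶ C} {p₀ : P ⟶ B} {p₁' : P' ⟶ C} {p₀' : P' ⟶ B}
    (h : EquivalentOver q₁ q₀ p₁ p₀) (i : P ≅ P') (h₁ : i.hom ≫ p₁' = p₁)
    (h₀ : i.hom ≫ p₀' = p₀) : EquivalentOver q₁ q₀ p₁' p₀' := by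
  obtain ⟨e, he, rfl, rfl⟩ := h
  exact ⟨e ≫ i.hom, isEquivalence_iff_isHtpyEquiv.2
    ((isEquivalence_iff_isHtpyEquiv.1 he).comp (.of_iso i)), by simp [h₁], by simp [h₀]⟩

lemma IsComma.exists_iso_map (F : CosmosFunctor K L) {A B C : K} {f : B ⟶ A} {g : C ⟶ A} {P : K}
    {p₁ : P ⟶ C} {p₀ : P ⟶ B} (h : IsComma f g p₁ p₀) {P' : L} {p₁' : P' ⟶ F.obj C}
    {p₀' : P' ⟶ F.obj B} (h' : IsComma (F.map₁ f) (F.map₁ g) p₁' p₀') :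
    ∃ e : P' ≅ F.obj P, e.hom ≫ F.map₁ p₁ = p₁' ∧ e.hom ≫ F.map₁ p₀ = p₀' := by
  obtain ⟨τ, hτ⟩ := (h.map F).exists_isCommaCone
  obtain ⟨τ', hτ'⟩ := h'.exists_isCommaCone
  exact hτ.exists_iso hτ'

lemma CosmosFunctor.IsWeakEquivalence.equivalentOver_comma_iff (hF : F.IsWeakEquivalence)
    {A B C : K} {f : B ⟶ A} {g : C ⟶ A} {P : K} {p₁ : P ⟶ C} {p₀ : P ⟶ B}
    (h : IsComma f g p₁ p₀) {P' : L} {p₁' : P' ⟶ F.obj C} {p₀' : P' ⟶ F.obj B}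
    (h' : IsComma (F.map₁ f) (F.map₁ g) p₁' p₀') {E : K} (q₁ : E ⟶ C) (q₀ : E ⟶ B) :
    EquivalentOver q₁ q₀ p₁ p₀ ↔ EquivalentOver (F.map₁ q₁) (F.map₁ q₀) p₁' p₀' := by
  obtain ⟨e, he₁, he₀⟩ := h.exists_iso_map F h'
  refine ⟨fun hE => ?_, fun hE => ?_⟩
  · exact (hE.map hF).comp_iso e.symm (by simp [← he₁]) (by simp [← he₀])
  · exact EquivalentOver.of_map hF h.isIsofibrationSpan (hE.comp_iso e he₁ he₀)

end

/-! ### Homotopy categories of equivalent quasi-categories -/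

open SSet.Truncated SSet.Truncated.HomotopyCategory

/-- The invertible morphism `(x, x₀) ⟶ (x, x₁)` in the homotopy category of `S ⊗ 𝕀`. -/
noncomputable def hoCylinderIso {S : SSet.{v}} (x : S _⦋0⦌) :
    (HomotopyCategory.mk (V := (SSet.truncation 2).obj (S ⊗ SSet.coherentIso.{v}))
      (x, SSet.coherentIso.x₀)) ≅ HomotopyCategory.mk (x, SSet.coherentIso.x₁) where
  hom := homMk (Edge.tensor (.id (X := (SSet.truncation 2).obj S) x)
    SSet.coherentIso.hom.toTruncated)
  inv := homMk (Edge.tensor (.id (X := (SSet.truncation 2).obj S) x)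
    SSet.coherentIso.inv.toTruncated)
  hom_inv_id :=
    (homMk_comp_homMk ((Edge.CompStruct.idComp _).tensor
      SSet.coherentIso.homInvId.toTruncated)).trans (homMk_id _)
  inv_hom_id :=
    (homMk_comp_homMk ((Edge.CompStruct.idComp _).tensor
      SSet.coherentIso.invHomId.toTruncated)).trans (homMk_id _)

/-- A homotopy parametrized by `𝕀` induces a natural isomorphism between functors on homotopy
categories. -/
noncomputable def hoNatIso {S T : SSet.{v}} (h : S ⊗ SSet.coherentIso.{v} ⟶ T) :
    (SSet.hoFunctor.map
      (lift (𝟙 S) (SSet.const SSet.coherentIso.x₀) ≫ h)).toFunctor ≅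
    (SSet.hoFunctor.map
      (lift (𝟙 S) (SSet.const SSet.coherentIso.x₁) ≫ h)).toFunctor :=
  mkNatIso (V := (SSet.truncation 2).obj S)
    (fun x => (mapHomotopyCategory ((SSet.truncation 2).map h)).mapIso (hoCylinderIso x)) (by
    intro x y e
    -- Naturality at an edge `e` is the image under `h` of the square `e × hom` in `S ⊗ 𝕀`.
    let G := mapHomotopyCategory ((SSet.truncation 2).map h)
    exact (G.map_comp _ _).symm.trans ((congrArg G.map
      (BinaryProduct.square e SSet.coherentIso.hom.{v}.toTruncated)).trans (G.map_comp _ _)))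

lemma isEquivalence_hoFunctor_map {S T : SSet.{v}} {f : S ⟶ T} (hf : IsQCatEquivalence f) :
    (SSet.hoFunctor.map f).toFunctor.IsEquivalence := by
  obtain ⟨g, h, k, h₀, h₁, k₀, k₁⟩ := hf
  let e : 𝟭 _ ≅ (SSet.hoFunctor.map f).toFunctor ⋙ (SSet.hoFunctor.map g).toFunctor :=
    eqToIso (by rw [h₀]; simp) ≪≫ hoNatIso h ≪≫ eqToIso (by rw [h₁]; simp)
  let e' : (SSet.hoFunctor.map g).toFunctor ⋙ (SSet.hoFunctor.map f).toFunctor ≅ 𝟭 _ :=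
    eqToIso (by rw [k₀]; simp) ≪≫ hoNatIso k ≪≫ eqToIso (by rw [k₁]; simp)
  exact (CategoryTheory.Equivalence.mk _ _ e e').isEquivalence_functor

section

variable {K : Type u₁} [Category.{v} K] [SimplicialCategory K]
  {L : Type u₂} [Category.{v} L] [SimplicialCategory L]

open CatEnrichedOrdinary in
/-- The hom-functors of the induced 2-functor are, up to the bijections between 1-cells and
objects of the homotopy categories, the functors `h Fun(A, B) ⥤ h Fun(FA, FB)`. -/
lemma isEquivalence_mapFunctor (F : EnrichedFunctor SSet.{v} K L) {A B : HomotopyTwoCategory K}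
    (h : IsQCatEquivalence (F.map A B)) :
    ((homotopyTwoFunctor F).mapFunctor A B).IsEquivalence := by
  have : (homFunctor F A B).IsEquivalence := isEquivalence_hoFunctor_map h
  have hmap {f g : A ⟶ B} (α : f ⟶ g) : ((homotopyTwoFunctor F).mapFunctor A B).map α =
      Hom.mk (eqToHom (homEquiv_twoMap F f) ≫ (homFunctor F A B).map (Hom.base α) ≫
        eqToHom (homEquiv_twoMap F g).symm) := rfl
  refine { faithful := ⟨?_⟩, full := ⟨?_⟩, essSurj := ⟨?_⟩ }
  · intro f g α β e
    rw [hmap, hmap] at e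
    have e' := congrArg Hom.base e
    simp only [base_mk, cancel_epi, cancel_mono] at e'
    exact Hom.ext _ _ ((homFunctor F A B).map_injective e')
  · intro f g (β : twoMap F f ⟶ twoMap F g)
    obtain ⟨α, hα⟩ := (homFunctor F A B).map_surjective
      (eqToHom (homEquiv_twoMap F f).symm ≫ Hom.base β ≫ eqToHom (homEquiv_twoMap F g))
    refine ⟨Hom.mk α, ?_⟩
    rw [hmap]
    apply Hom.ext
    rw [base_mk, base_mk, hα]
    simp
  · intro y
    let x := (homFunctor F A B).objPreimage (homEquiv y)
    let i : (homFunctor F A B).obj x ≅ homEquiv y := (homFunctor F A B).objObjPreimageIso _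
    refine ⟨homEquiv.symm x, ?_⟩
    let j : homEquiv (twoMap F (homEquiv.symm x)) ≅ homEquiv y :=
      eqToIso ((homEquiv_twoMap F _).trans (by rw [Equiv.apply_symm_apply])) ≪≫ i
    exact ⟨⟨Hom.mk j.hom, Hom.mk j.inv, Hom.ext _ _ j.hom_inv_id, Hom.ext _ _ j.inv_hom_id⟩⟩

end

/-! ### Biequivalences -/

lemma bijective_isomorphismClasses_map {C D : Cat.{v, u}} (G : C ⟶ D)
    [G.toFunctor.IsEquivalence] : Function.Bijective (isomorphismClasses.map G) := by
  constructor
  · rintro ⟨x⟩ ⟨y⟩ h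
    obtain ⟨e⟩ := Quotient.exact h
    exact Quotient.sound ⟨G.toFunctor.preimageIso e⟩
  · rintro ⟨y⟩
    exact ⟨Quotient.mk _ (G.toFunctor.objPreimage y),
      Quotient.sound ⟨G.toFunctor.objObjPreimageIso y⟩⟩

section Biequivalence

open Bicategory

variable {𝓑 : Type u₁} [Bicategory.{v, v} 𝓑] {𝓒 : Type u₂} [Bicategory.{v, v} 𝓒]

lemma IsEquivalence₂.congr {A B : 𝓑} {f f' : A ⟶ B} (h : IsEquivalence₂ f) (e : f ≅ f') :
    IsEquivalence₂ f' := by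
  obtain ⟨g, ⟨i⟩, ⟨j⟩⟩ := h
  exact ⟨g, ⟨i ≪≫ whiskerRightIso e g⟩, ⟨whiskerLeftIso g e.symm ≪≫ j⟩⟩

lemma IsEquivalence₂.map (G : StrictPseudofunctor 𝓑 𝓒) {A B : 𝓑} {f : A ⟶ B}
    (h : IsEquivalence₂ f) : IsEquivalence₂ (G.map f) := by
  obtain ⟨g, ⟨i⟩, ⟨j⟩⟩ := h
  exact ⟨G.map g, ⟨(G.mapId A).symm ≪≫ G.map₂Iso i ≪≫ G.mapComp f g⟩,
    ⟨(G.mapComp g f).symm ≪≫ G.map₂Iso j ≪≫ G.mapId B⟩⟩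

/-- Whiskering with an equivalence reflects invertibility of 2-cells. -/
lemma IsEquivalence₂.isIso_of_whiskerLeft {X' X A : 𝓑} {e : X' ⟶ X} (h : IsEquivalence₂ e)
    {f g : X ⟶ A} (α : f ⟶ g) [IsIso (e ◁ α)] : IsIso α := by
  obtain ⟨e', -, ⟨j⟩⟩ := h
  have h₁ : IsIso ((e' ≫ e) ◁ α) := by
    rw [comp_whiskerLeft]
    infer_instance
  have h₂ : IsIso (𝟙 X ◁ α) := by
    have : 𝟙 X ◁ α = j.inv ▷ f ≫ (e' ≫ e) ◁ α ≫ j.hom ▷ g := by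
      rw [Bicategory.whisker_exchange, ← Bicategory.comp_whiskerRight_assoc]
      simp
    rw [this]
    infer_instance
  have : α = (Bicategory.leftUnitor f).inv ≫ 𝟙 X ◁ α ≫ (Bicategory.leftUnitor g).hom := by simp
  rw [this]
  infer_instance

namespace IsBiequivalence

variable {G : StrictPseudofunctor 𝓑 𝓒}

lemma isEquivalence₂_iff (hG : IsBiequivalence G) {A B : 𝓑} (f : A ⟶ B) :
    IsEquivalence₂ f ↔ IsEquivalence₂ (G.map f) := by
  refine ⟨.map G, ?_⟩
  rintro ⟨g', ⟨i⟩, ⟨j⟩⟩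
  have := hG.2
  let g := (G.mapFunctor B A).objPreimage g'
  let k : G.map g ≅ g' := (G.mapFunctor B A).objObjPreimageIso g'
  exact ⟨g,
    ⟨(G.mapFunctor A A).preimageIso
      (G.mapId A ≪≫ i ≪≫ whiskerLeftIso _ k.symm ≪≫ (G.mapComp f g).symm)⟩,
    ⟨(G.mapFunctor B B).preimageIso
      (G.mapComp g f ≪≫ whiskerRightIso k _ ≪≫ j ≪≫ (G.mapId B).symm)⟩⟩

lemma areEquivalent_iff (hG : IsBiequivalence G) (A B : 𝓑) :
    AreEquivalent A B ↔ AreEquivalent (G.obj A) (G.obj B) := by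
  refine ⟨fun ⟨f, hf⟩ => ⟨G.map f, hf.map G⟩, fun ⟨f', hf'⟩ => ?_⟩
  have := hG.2
  exact ⟨(G.mapFunctor A B).objPreimage f', (hG.isEquivalence₂_iff _).2
    (hf'.congr ((G.mapFunctor A B).objObjPreimageIso f').symm)⟩

lemma isGroupoidal_iff (hG : IsBiequivalence G) (A : 𝓑) :
    IsGroupoidal A ↔ IsGroupoidal (G.obj A) := by
  have := hG.2
  constructor
  · intro hA Y f g α
    obtain ⟨X, e, he⟩ := hG.1 Y
    -- Up to isomorphisms, `e ◁ α` is the image of a 2-cell `β` with codomain `A`.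
    let i := (G.mapFunctor X A).objObjPreimageIso (e ≫ f)
    let j := (G.mapFunctor X A).objObjPreimageIso (e ≫ g)
    obtain ⟨β, hβ⟩ := (G.mapFunctor X A).map_surjective (i.hom ≫ e ◁ α ≫ j.inv)
    have := hA X _ _ β
    have h : e ◁ α = i.inv ≫ (G.mapFunctor X A).map β ≫ j.hom := by
      rw [hβ, Category.assoc, Category.assoc, Iso.inv_hom_id, Category.comp_id,
        Iso.inv_hom_id_assoc]
    have : IsIso (e ◁ α) := by
      rw [h]
      infer_instance
    exact he.isIso_of_whiskerLeft α
  · intro hA X f g α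
    have : IsIso ((G.mapFunctor X A).map α) := hA _ _ _ _
    exact isIso_of_reflects_iso α (G.mapFunctor X A)

end IsBiequivalence

end Biequivalence

section

variable {K : Type u₁} [Category.{v} K] [SimplicialCategory K] [InfinityCosmos K]
  {L : Type u₂} [Category.{v} L] [SimplicialCategory L] [InfinityCosmos L]
  {F : CosmosFunctor K L}

lemma CosmosFunctor.IsWeakEquivalence.isBiequivalence (hF : F.IsWeakEquivalence) :
    IsBiequivalence F.twoFunctor :=
  ⟨hF.surjective, fun A B =>
    isEquivalence_mapFunctor F.toEnrichedFunctor (hF.local_equivalence A B)⟩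

end

end InfCosmos

theorem mainTheorem2 {K : Type u₁} [Category.{v} K] [SimplicialCategory K]
    [InfCosmos.InfinityCosmos K] {L : Type u₂} [Category.{v} L] [SimplicialCategory L]
    [InfCosmos.InfinityCosmos L] (F : InfCosmos.CosmosFunctor K L) (hF : F.IsWeakEquivalence) :
    -- `F₂` is a biequivalence
    InfCosmos.IsBiequivalence F.twoFunctor ∧
    -- `F₂` induces bijections between isomorphism classes of parallel functors
    (∀ A B : InfCosmos.HomotopyTwoCategory K, Function.Bijective
      (isomorphismClasses.map (F.twoFunctor.mapFunctor A B).toCatHom)) ∧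
    -- groupoidal objects
    (∀ A : InfCosmos.HomotopyTwoCategory K,
      InfCosmos.IsGroupoidal A ↔ InfCosmos.IsGroupoidal (F.twoFunctor.obj A)) ∧
    -- equivalence of objects
    (∀ A B : InfCosmos.HomotopyTwoCategory K,
      InfCosmos.AreEquivalent A B ↔
        InfCosmos.AreEquivalent (F.twoFunctor.obj A) (F.twoFunctor.obj B)) ∧
    -- equivalences, in the homotopy 2-categories and in the ∞-cosmoi
    (∀ {A B : InfCosmos.HomotopyTwoCategory K} (f : A ⟶ B),
      InfCosmos.IsEquivalence₂ f ↔ InfCosmos.IsEquivalence₂ (F.twoFunctor.map f)) ∧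
    (∀ {A B : K} (f : A ⟶ B), InfCosmos.IsEquivalence f ↔ InfCosmos.IsEquivalence (F.map₁ f)) ∧
    -- comma objects
    (∀ {A B C : K} (f : B ⟶ A) (g : C ⟶ A) {P : K} (p₁ : P ⟶ C) (p₀ : P ⟶ B),
      InfCosmos.IsComma f g p₁ p₀ →
      ∀ {P' : L} (p₁' : P' ⟶ F.obj C) (p₀' : P' ⟶ F.obj B),
        InfCosmos.IsComma (F.map₁ f) (F.map₁ g) p₁' p₀' →
        (∃ e : P' ≅ F.obj P, e.hom ≫ F.map₁ p₁ = p₁' ∧ e.hom ≫ F.map₁ p₀ = p₀') ∧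
        ∀ {E : K} (q₁ : E ⟶ C) (q₀ : E ⟶ B), InfCosmos.IsIsofibrationSpan q₁ q₀ →
          (InfCosmos.EquivalentOver q₁ q₀ p₁ p₀ ↔
            InfCosmos.EquivalentOver (F.map₁ q₁) (F.map₁ q₀) p₁' p₀')) := by
  have hG := hF.isBiequivalence
  refine ⟨hG, fun A B => ?_, hG.isGroupoidal_iff, hG.areEquivalent_iff, hG.isEquivalence₂_iff,
    hF.isEquivalence_map_iff, fun f g _ p₁ p₀ h _ p₁' p₀' h' =>
      ⟨h.exists_iso_map F h', fun q₁ q₀ _ => hF.equivalentOver_comma_iff h h' q₁ q₀⟩⟩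
  have : (F.twoFunctor.mapFunctor A B).toCatHom.toFunctor.IsEquivalence := hG.2 A B
  exact InfCosmos.bijective_isomorphismClasses_map _
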